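/- Let $S$ be an integrally closed Noetherian domain with fraction field $L$, and let $p$ be a prime number whose image in $S$ is a nonzero prime element. Let $f_1,\dots,f_r\in S$ be nonzero nonunits such that: 1. each $f_i$ is square-free, i.e. $f_iS_Q=QS_Q$ for every height-one prime $Q$ of $S$ containing $f_i$; 2. for $i\neq j$, no height-one prime of $S$ contains both $f_i$ and $f_j$; 3. for each $i$ there is $h_i\in S$ with $f_i\equiv h_i^p \pmod{p^2S}$. Let $n_i=pd_i$, where each $d_i$ is a positive integer whose image in $S$ is a unit, and let $K=L(\omega_1,\dots,\omega_r)$ be an extension field of $L$ generated by elements $\omega_i$ with $\omega_i^{n_i}=f_i$ (so $\omega_i=\sqrt[n_i]{f_i}$ is an arbitrary choice of root). Then the integral closure $R$ of $S$ in $K$ is a free $S$-module. Moreover, if $S$ is Cohen–Macaulay, or if $S$ is an unramified regular local ring of mixed characteristic $p$ (a regular local ring of characteristic zero whose maximal ideal $\mathfrak m$ satisfies $p\in\mathfrak m\setminus\mathfrak m^2$), then $R$ is Cohen–Macaulay. -/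

import Mathlib

/-- `f` is square-free in `S`: `f S_Q = Q S_Q` for every height one prime `Q` of `S`
containing `f`. -/
def IsSquareFreeElement {S : Type*} [CommRing S] (f : S) : Prop :=
  ∀ (Q : Ideal S) [Q.IsPrime], Q.height = 1 → f ∈ Q →
    (Ideal.span {f}).map (algebraMap S (Localization.AtPrime Q)) =
      Q.map (algebraMap S (Localization.AtPrime Q))

/-- No two members (with distinct indices) of the family `f` lie in a common height one prime. -/
def NoCommonHeightOnePrime {S : Type*} [CommRing S] {r : ℕ} (f : Fin r → S) : Prop :=
  ∀ i j : Fin r, i ≠ j → ∀ Q : Ideal S, Q.IsPrime → Q.height = 1 → ¬ (f i ∈ Q ∧ f j ∈ Q)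

/-- `f` is a `p`-th power modulo `p² S`. -/
def IsPthPowerModSq {S : Type*} [CommRing S] (p : ℕ) (f : S) : Prop :=
  ∃ h : S, f - h ^ p ∈ Ideal.span {(p : S) ^ 2}

/-- The depth of a local ring: the supremum of the lengths of the regular sequences contained in
the maximal ideal. -/
noncomputable def localRingDepth (R : Type*) [CommRing R] [IsLocalRing R] : ℕ∞ :=
  ⨆ rs : {rs : List R // RingTheory.Sequence.IsRegular R rs ∧
    ∀ x ∈ rs, x ∈ IsLocalRing.maximalIdeal R}, (rs.1.length : ℕ∞)

/-- A Cohen-Macaulay ring: a Noetherian ring all of whose localizations at maximal ideals have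
depth equal to their Krull dimension. -/
structure IsCohenMacaulayRing (R : Type*) [CommRing R] : Prop where
  isNoetherianRing : IsNoetherianRing R
  depth_eq_dim : ∀ (m : Ideal R) [m.IsMaximal],
    (localRingDepth (Localization.AtPrime m) : WithBot ℕ∞) =
      ringKrullDim (Localization.AtPrime m)

/-- An unramified regular local ring of mixed characteristic `p`: a regular local ring `S` of
characteristic zero, with maximal ideal `m`, such that `p ∈ m` and `p ∉ m²`. -/
structure IsUnramifiedRegularLocalRing (p : ℕ) (S : Type*) [CommRing S] : Prop
    extends IsRegularLocalRing S where
  charZero : CharZero S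
  natCast_mem : (p : S) ∈ IsLocalRing.maximalIdeal S
  natCast_notMem_sq : (p : S) ∉ IsLocalRing.maximalIdeal S ^ 2

/-! The ring `R` has an explicit basis over `S`, checked by duality for the trace. With `t_i = ω_i ^
d_i - h_i`, it consists of the products of the `ω_i ^ j_i * t_i ^ e_i`, for `j_i < d_i` and `e_i <
p`, divided by `p ^ ⌊∑ e_i / (p - 1)⌋`.

Choose `π` with `π ^ (p - 1) = p` in an algebraic closure. The congruence modulo `p²` makes each
`t_i / π` integral (`isIntegral_sub_div`), so `π ^ ∑ e_i` divides the numerator and the quotient is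
integral. The coordinates for this basis are traces against explicit dual elements
(`radicalCoord_radicalBasisElement`), and it remains to see that they map `R` into `S`.

Estimating the dual elements shows that the coordinate of an integral `z` is `Tr y`, where `y` is an
integral multiple of `W / G`, with `W = π * ∏ ω_i` and `G = p * ∏ f_i`. A power of `W / G` lies in
`L`, so every conjugate of `y`, hence `Tr y`, is again an integral multiple of `W / G`
(`isIntegral_trace_div`). Thus `x = G * Tr y` lies in `S` and is an integral multiple of `W`. Some
power of `W` lies in `G * S`, so `G` divides a power of `x`. Since `G` is square-free and `S` is
normal, `G` divides `x`, that is, `Tr y` lies in `S` (`exists_algebraMap_eq_radicalCoord`).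

The trace formulas need the monomials in the `ω_i` to be an `L`-basis of `K`. The same trace
argument proves their independence by induction on `r` (`linearIndependent_prod_pow`): a factor of
`X ^ n - f_i` over the field of the other radicals would produce a proper fractional power of `f_i`,
which is excluded at a height one prime over `f_i`.

Finally, a finite free extension inherits the Cohen-Macaulay property, and regular local rings have
it. -/

/-! ### Divisibility in Noetherian normal domains. -/

/-- In a Noetherian normal domain, an associated prime of a nonzero principal ideal has height
one. -/
theorem Ideal.height_eq_one_of_forall_mem_iff_dvd_mul {S : Type*} [CommRing S] [IsDomain S]
    [IsNoetherianRing S] [IsIntegrallyClosed S] {g y : S} (hg : g ≠ 0) (Q : Ideal S) [Q.IsPrime]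
    (hQ : ∀ a, a ∈ Q ↔ g ∣ a * y) : Q.height = 1 := by
  have hgQ : g ∈ Q := (hQ g).2 (dvd_mul_right g y)
  have hQbot : Q ≠ ⊥ := fun h => hg (by simpa [h] using hgQ)
  -- Multiplication by `y / g` maps `Q` into `S`. If some image is outside `Q`, then `Q` is locally
  -- principal and Krull's theorem applies. Otherwise `Q` is stable, so `y / g` is integral, hence
  -- in `S`, and `Q` would be the unit ideal.
  by_cases H : ∃ a ∈ Q, ∃ u, u ∉ Q ∧ a * y = g * u
  · obtain ⟨a, haQ, u, hu, hau⟩ := H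
    have hmin : Q ∈ (Ideal.span {a}).minimalPrimes := by
      refine ⟨⟨inferInstance, (Ideal.span_singleton_le_iff_mem _).2 haQ⟩, ?_⟩
      rintro P ⟨hP, haP⟩ hPQ b hb
      obtain ⟨c, hc⟩ := (hQ b).1 hb
      have h1 : b * u = a * c := by
        apply mul_left_cancel₀ hg
        linear_combination (-b) * hau + a * hc
      have h2 : b * u ∈ P := by
        rw [h1]
        exact P.mul_mem_right _ (haP (Ideal.mem_span_singleton_self a))
      exact (hP.mem_or_mem h2).resolve_right fun h => hu (hPQ h)
    apply le_antisymm (Ideal.height_le_one_of_isPrincipal_of_mem_minimalPrimes _ _ hmin)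
    rw [Order.one_le_iff_pos, pos_iff_ne_zero, Ne, Ideal.height_eq_zero_iff_eq_bot]
    exact hQbot
  · push Not at H
    exfalso
    let L := FractionRing S
    have hgL : algebraMap S L g ≠ 0 := by simpa using hg
    have hint : IsIntegral S (algebraMap S L y / algebraMap S L g) := by
      refine isIntegral_of_smul_mem_submodule (Submodule.map (Algebra.linearMap S L) Q) ?_
        ((IsNoetherian.noetherian Q).map _) _ ?_
      · rw [Submodule.ne_bot_iff]
        exact ⟨algebraMap S L g, ⟨g, hgQ, rfl⟩, hgL⟩
      · rintro _ ⟨b, hb, rfl⟩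
        obtain ⟨c, hc⟩ := (hQ b).1 hb
        refine ⟨c, ?_, ?_⟩
        · by_contra hcQ
          exact H b hb c hcQ hc
        · have := congrArg (algebraMap S L) hc
          simp only [map_mul] at this
          simp only [Algebra.linearMap_apply, smul_eq_mul]
          rw [div_mul_eq_mul_div, eq_div_iff hgL]
          linear_combination -this
    obtain ⟨s, hs⟩ := IsIntegrallyClosed.isIntegral_iff.1 hint
    rw [eq_div_iff hgL, ← map_mul] at hs
    have hsy := IsFractionRing.injective S L hs
    refine Ideal.IsPrime.ne_top ‹Q.IsPrime› ((Ideal.eq_top_iff_one _).2 ((hQ 1).2 ?_))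
    rw [one_mul, ← hsy]
    exact dvd_mul_left _ _

/-- Divisibility by a nonzero element of a Noetherian normal domain can be tested at the height
one primes. -/
theorem dvd_of_forall_height_eq_one {S : Type*} [CommRing S] [IsDomain S]
    [IsNoetherianRing S] [IsIntegrallyClosed S] {g x : S} (hg : g ≠ 0)
    (h : ∀ Q : Ideal S, Q.IsPrime → Q.height = 1 → g ∈ Q → ∃ u, u ∉ Q ∧ g ∣ u * x) : g ∣ x := by
  by_contra hgx
  have hx : (Ideal.Quotient.mk (Ideal.span {g}) x) ≠ 0 := by
    rwa [Ne, Ideal.Quotient.eq_zero_iff_mem, Ideal.mem_span_singleton]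
  obtain ⟨Q, hQ, hle⟩ := exists_le_isAssociatedPrime_of_isNoetherianRing S _ hx
  rw [isAssociatedPrime_iff] at hQ
  obtain ⟨hQp, w, hy⟩ := hQ
  obtain ⟨y, rfl⟩ := Ideal.Quotient.mk_surjective w
  have key : ∀ a z : S, a ∈ (⊥ : Submodule S (S ⧸ Ideal.span {g})).colon
      {Ideal.Quotient.mk (Ideal.span {g}) z} ↔ g ∣ a * z := by
    intro a z
    rw [Submodule.mem_colon_singleton, Submodule.mem_bot, Algebra.smul_def,
      Ideal.Quotient.algebraMap_eq, ← map_mul, Ideal.Quotient.eq_zero_iff_mem,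
      Ideal.mem_span_singleton]
  have hQ' : ∀ a, a ∈ Q ↔ g ∣ a * y := fun a => by rw [hy, key]
  obtain ⟨u, hu, hgu⟩ := h Q hQp (Ideal.height_eq_one_of_forall_mem_iff_dvd_mul hg Q hQ')
    ((hQ' g).2 (dvd_mul_right g y))
  exact hu (hle ((key u x).2 hgu))

/-- An element that generates every height one prime containing it, after localization, divides
every element having a power divisible by it. -/
theorem dvd_of_dvd_pow_of_forall_height_eq_one {S : Type*} [CommRing S] [IsDomain S]
    [IsNoetherianRing S] [IsIntegrallyClosed S] {g x : S} {D : ℕ} (hg : g ≠ 0)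
    (h : ∀ Q : Ideal S, Q.IsPrime → Q.height = 1 → g ∈ Q → ∀ q ∈ Q, ∃ u, u ∉ Q ∧ g ∣ u * q)
    (hx : g ∣ x ^ D) : g ∣ x :=
  dvd_of_forall_height_eq_one hg fun Q hQ hQ1 hgQ => h Q hQ hQ1 hgQ x <|
    hQ.mem_of_pow_mem D (Ideal.mem_of_dvd Q hx hgQ)

theorem IsSquareFreeElement.exists_dvd_mul {S : Type*} [CommRing S] [IsDomain S] {f : S}
    (hf : IsSquareFreeElement f) {Q : Ideal S} (hQ : Q.IsPrime) (hQ1 : Q.height = 1) (hfQ : f ∈ Q)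
    {q : S} (hq : q ∈ Q) : ∃ u, u ∉ Q ∧ f ∣ u * q := by
  have h := hf Q hQ1 hfQ
  have h1 : algebraMap S (Localization.AtPrime Q) q ∈
      (Ideal.span {f}).map (algebraMap S (Localization.AtPrime Q)) := by
    rw [h]
    exact Ideal.mem_map_of_mem _ hq
  rw [IsLocalization.algebraMap_mem_map_algebraMap_iff Q.primeCompl] at h1
  obtain ⟨u, hu, hfu⟩ := h1
  exact ⟨u, hu, Ideal.mem_span_singleton.1 hfu⟩

/-- A square-free element that is a `p`-th power modulo `p²` is prime to `p`. -/
theorem IsSquareFreeElement.not_dvd_of_isPthPowerModSq {S : Type*} [CommRing S] [IsDomain S]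
    [IsNoetherianRing S] {p : ℕ} (hp : p.Prime) (hpS : Prime (p : S)) {f : S}
    (hf : IsSquareFreeElement f) (hfp : IsPthPowerModSq p f) : ¬ (p : S) ∣ f := by
  intro hpf
  obtain ⟨h, hh⟩ := hfp
  obtain ⟨a, ha⟩ := Ideal.mem_span_singleton.1 hh
  have hph : (p : S) ∣ h := by
    apply hpS.dvd_of_dvd_pow (n := p)
    have : h ^ p = f - p ^ 2 * a := by linear_combination -ha
    rw [this]
    exact dvd_sub hpf ((dvd_pow_self _ two_ne_zero).mul_right _)
  have hp2 : (p : S) ^ 2 ∣ f := by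
    have : f = h ^ p + p ^ 2 * a := by linear_combination ha
    rw [this]
    exact dvd_add ((pow_dvd_pow _ hp.two_le).trans (pow_dvd_pow_of_dvd hph p)) (dvd_mul_right _ _)
  -- At the height one prime `(p)`, square-freeness makes `f` a local generator, against `p ^ 2 ∣
  -- f`.
  have hQ : (Ideal.span {(p : S)}).IsPrime := (Ideal.span_singleton_prime hpS.ne_zero).2 hpS
  obtain ⟨u, hu, hfu⟩ := hf.exists_dvd_mul hQ
    (Ideal.height_span_singleton_eq_one_of_mem_nonZeroDivisors
      (mem_nonZeroDivisors_of_ne_zero hpS.ne_zero) hpS.not_isUnit)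
    (Ideal.mem_span_singleton.2 hpf) (Ideal.mem_span_singleton_self (p : S))
  have h2 : (p : S) * p ∣ p * u := by
    rw [← pow_two, mul_comm (p : S) u]
    exact hp2.trans hfu
  exact hu (Ideal.mem_span_singleton.2 ((mul_dvd_mul_iff_left hpS.ne_zero).1 h2))

/-! ### Cohen-Macaulay rings: finite flat extensions and regular local rings. -/

section CohenMacaulay

open IsLocalRing RingTheory.Sequence Pointwise

theorem localRingDepth_le_ringKrullDim (R : Type*) [CommRing R] [IsLocalRing R]
    [IsNoetherianRing R] : (localRingDepth R : WithBot ℕ∞) ≤ ringKrullDim R := by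
  have hbot : ringKrullDim R ≠ ⊥ := ringKrullDim_ne_bot
  obtain ⟨d, hd⟩ := WithBot.ne_bot_iff_exists.1 hbot
  rw [← hd, WithBot.coe_le_coe, localRingDepth]
  refine iSup_le fun ⟨rs, hrs, _⟩ => ?_
  have h := ringKrullDim_add_length_eq_ringKrullDim_of_isRegular rs hrs
  have : Nontrivial (R ⧸ Ideal.ofList rs) := by
    refine Ideal.Quotient.nontrivial_iff.2 fun h => hrs.2 ?_
    simp [h]
  rw [← WithBot.coe_le_coe, hd, ← h]
  simpa using! add_le_add_left (ringKrullDim_nonneg_of_nontrivial (R := R ⧸ Ideal.ofList rs))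
    (rs.length : WithBot ℕ∞)

/-- A Noetherian local ring with a long enough weakly regular sequence has depth equal to its
dimension. -/
theorem localRingDepth_eq_ringKrullDim_of_isWeaklyRegular {R : Type*} [CommRing R] [IsLocalRing R]
    [IsNoetherianRing R] {rs : List R} (hrs : IsWeaklyRegular R rs)
    (hmem : ∀ x ∈ rs, x ∈ maximalIdeal R) (hdim : ringKrullDim R ≤ rs.length) :
    (localRingDepth R : WithBot ℕ∞) = ringKrullDim R := by
  apply le_antisymm (localRingDepth_le_ringKrullDim R)
  have hreg : IsRegular R rs :=
    (IsLocalRing.isRegular_iff_isWeaklyRegular_of_subset_maximalIdeal hmem).2 hrs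
  refine hdim.trans ?_
  have : (rs.length : ℕ∞) ≤ localRingDepth R :=
    le_iSup (fun rs : {rs : List R // IsRegular R rs ∧ ∀ x ∈ rs, x ∈ maximalIdeal R} =>
      (rs.1.length : ℕ∞)) ⟨rs, hreg, hmem⟩
  exact_mod_cast this

theorem exists_isWeaklyRegular_of_localRingDepth_eq {R : Type*} [CommRing R] [IsLocalRing R]
    [IsNoetherianRing R] (h : (localRingDepth R : WithBot ℕ∞) = ringKrullDim R) :
    ∃ rs : List R, IsWeaklyRegular R rs ∧ (∀ x ∈ rs, x ∈ maximalIdeal R) ∧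
      ringKrullDim R = rs.length := by
  have hne : localRingDepth R ≠ ⊤ := by
    intro ht
    have : ringKrullDim R < ⊤ := ringKrullDim_lt_top
    rw [← h, ht] at this
    exact this.ne rfl
  have : Nonempty {rs : List R // IsRegular R rs ∧ ∀ x ∈ rs, x ∈ maximalIdeal R} :=
    ⟨⟨[], .nil R R, by simp⟩⟩
  obtain ⟨⟨rs, hrs, hmem⟩, hlen⟩ := ENat.exists_eq_iSup_of_lt_top
    (f := fun rs : {rs : List R // IsRegular R rs ∧ ∀ x ∈ rs, x ∈ maximalIdeal R} =>
      (rs.1.length : ℕ∞)) (lt_top_iff_ne_top.2 hne)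
  refine ⟨rs, hrs.1, hmem, ?_⟩
  rw [← h, localRingDepth, ← hlen]
  rfl

/-- Along an integral extension the height of a prime is at most that of its contraction. -/
theorem Ideal.height_le_height_under_of_isIntegral {A B : Type*} [CommRing A] [CommRing B]
    [Algebra A B] [Algebra.IsIntegral A B] (P : Ideal B) [P.IsPrime] :
    P.height ≤ (P.under A).height := by
  let F : PrimeSpectrum B → PrimeSpectrum A := PrimeSpectrum.comap (algebraMap A B)
  have hF : StrictMono F := fun I J hIJ =>
    Ideal.IsIntegral.comap_lt_comap (R := A) (show I.asIdeal < J.asIdeal from hIJ)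
  have h := Order.height_le_height_apply_of_strictMono F hF ⟨P, inferInstance⟩
  rwa [← PrimeSpectrum.height_eq_orderHeight, ← PrimeSpectrum.height_eq_orderHeight] at h

/-- A finite flat extension of a Cohen-Macaulay ring is Cohen-Macaulay. -/
theorem IsCohenMacaulayRing.of_finite_of_flat {A B : Type*} [CommRing A] [CommRing B]
    [Algebra A B] [Module.Finite A B] [Module.Flat A B] (hA : IsCohenMacaulayRing A) :
    IsCohenMacaulayRing B := by
  have := hA.isNoetherianRing
  have hB : IsNoetherianRing B := IsNoetherianRing.of_finite A B
  refine ⟨hB, fun n _ => ?_⟩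
  let m : Ideal A := n.under A
  have hm : m.IsMaximal := Ideal.isMaximal_comap_of_isIntegral_of_isMaximal n
  obtain ⟨rs, hrs, hmem, hlen⟩ := exists_isWeaklyRegular_of_localRingDepth_eq (hA.depth_eq_dim m)
  let φ := Localization.localRingHom m n (algebraMap A B) rfl
  let _ : Algebra (Localization.AtPrime m) (Localization.AtPrime n) := φ.toAlgebra
  have hflat : Module.Flat (Localization.AtPrime m) (Localization.AtPrime n) :=
    RingHom.Flat.localRingHom (f := algebraMap A B)
      ((RingHom.flat_algebraMap_iff).2 inferInstance) n m rfl
  refine localRingDepth_eq_ringKrullDim_of_isWeaklyRegular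
    (hrs.of_flat (S := Localization.AtPrime n)) ?_ ?_
  · intro x hx
    obtain ⟨y, hy, rfl⟩ := List.mem_map.1 hx
    have : IsLocalHom φ := Localization.isLocalHom_localRingHom m n (algebraMap A B) rfl
    exact map_nonunit φ y (hmem y hy)
  · rw [List.length_map, ← hlen, IsLocalization.AtPrime.ringKrullDim_eq_height n,
      IsLocalization.AtPrime.ringKrullDim_eq_height m]
    exact_mod_cast Ideal.height_le_height_under_of_isIntegral (A := A) n

/-- When `x` is written in terms of the generators, some coefficient is a unit, since otherwise `x`
would lie in the square of the maximal ideal. The corresponding generator is redundant modulo `x`.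
-/
theorem IsLocalRing.exists_finset_erase_span_map_mk {R : Type*} [CommRing R] [IsLocalRing R]
    [DecidableEq R] {s : Finset R} (hs : Ideal.span (s : Set R) = maximalIdeal R) {x : R}
    (hx : x ∈ maximalIdeal R) (hx2 : x ∉ maximalIdeal R ^ 2) :
    ∃ i ∈ s, Ideal.span (Ideal.Quotient.mk (Ideal.span {x}) '' (s.erase i : Set R)) =
      (maximalIdeal R).map (Ideal.Quotient.mk (Ideal.span {x})) := by
  have hx' := hx
  rw [← hs, Ideal.span, Submodule.mem_span_finset] at hx'
  obtain ⟨a, -, ha⟩ := hx'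
  have : ∃ i ∈ s, IsUnit (a i) := by
    by_contra! H
    apply hx2
    rw [← ha, pow_two]
    refine sum_mem fun i hi => Ideal.mul_mem_mul ((mem_maximalIdeal _).2 (H i hi)) ?_
    rw [← hs]
    exact Ideal.subset_span hi
  obtain ⟨i, hi, hu⟩ := this
  refine ⟨i, hi, ?_⟩
  rw [← hs, Ideal.map_span]
  apply le_antisymm
  · exact Ideal.span_mono (Set.image_mono (by simp))
  · rw [Ideal.span_le]
    rintro _ ⟨j, hj, rfl⟩
    by_cases hji : j = i
    · subst hji
      have h0 : Ideal.Quotient.mk (Ideal.span {x}) (∑ i ∈ s, a i • i) = 0 := by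
        rw [ha]
        exact Ideal.Quotient.eq_zero_iff_mem.2 (Ideal.mem_span_singleton_self x)
      rw [← Finset.add_sum_erase _ _ hi, map_add, smul_eq_mul, map_mul, map_sum] at h0
      have h1 := eq_neg_of_add_eq_zero_left h0
      rw [SetLike.mem_coe, ← Ideal.unit_mul_mem_iff_mem _
        (hu.map (Ideal.Quotient.mk (Ideal.span {x}))), h1]
      refine neg_mem (sum_mem fun k hk => ?_)
      rw [smul_eq_mul, map_mul]
      exact Ideal.mul_mem_left _ _ (Ideal.subset_span ⟨k, hk, rfl⟩)
    · exact Ideal.subset_span ⟨j, by simpa using ⟨hj, hji⟩, rfl⟩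

theorem IsLocalRing.spanFinrank_maximalIdeal_quotient_lt {R : Type*} [CommRing R] [IsLocalRing R]
    [IsNoetherianRing R] {x : R} [IsLocalRing (R ⧸ Ideal.span {x})]
    (hx : x ∈ maximalIdeal R) (hx2 : x ∉ maximalIdeal R ^ 2) :
    (maximalIdeal (R ⧸ Ideal.span {x})).spanFinrank + 1 ≤ (maximalIdeal R).spanFinrank := by
  classical
  obtain ⟨s, hcard, hs⟩ :=
    (IsNoetherian.noetherian (maximalIdeal R)).exists_span_finset_card_eq_spanFinrank
  obtain ⟨i, hi, hspan⟩ := IsLocalRing.exists_finset_erase_span_map_mk hs hx hx2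
  have hmap : (maximalIdeal R).map (Ideal.Quotient.mk (Ideal.span {x})) =
      maximalIdeal (R ⧸ Ideal.span {x}) :=
    IsLocalRing.map_maximalIdeal_of_surjective _ Ideal.Quotient.mk_surjective
  rw [← hmap, ← hspan, ← hcard, ← Finset.card_erase_add_one hi]
  gcongr
  refine (Submodule.spanFinrank_span_le_ncard_of_finite ((Finset.finite_toSet _).image _)).trans ?_
  exact (Set.ncard_image_le (Finset.finite_toSet _)).trans (Set.ncard_coe_finset _).le

/-- Induction by cutting with a parameter outside `m²`. Being a domain is carried along because it
is what makes that parameter regular. -/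
theorem IsRegularLocalRing.isDomain_and_exists_isWeaklyRegular (d : ℕ) :
    ∀ (R : Type*) [CommRing R] [IsRegularLocalRing R], (maximalIdeal R).spanFinrank = d →
      IsDomain R ∧ ∃ rs : List R, IsWeaklyRegular R rs ∧ (∀ x ∈ rs, x ∈ maximalIdeal R) ∧
        rs.length = d := by
  induction d with
  | zero =>
    intro R _ _ h
    refine ⟨?_, [], .nil R R, by simp, rfl⟩
    rw [Submodule.spanFinrank_eq_zero_iff_eq_bot (IsNoetherian.noetherian _)] at h
    exact (IsLocalRing.isField_iff_maximalIdeal_eq.2 h).isDomain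
  | succ d ih =>
    intro R _ _ h
    have hdim : ((d + 1 : ℕ) : WithBot ℕ∞) = ringKrullDim R := by
      rw [← h]
      exact IsRegularLocalRing.spanFinrank_maximalIdeal
    have hmbot : maximalIdeal R ≠ ⊥ := fun hb => by simp [hb] at h
    have hfin : (minimalPrimes R).Finite := minimalPrimes.finite_of_isNoetherianRing R
    -- Prime avoidance gives `x` outside `m²` and all minimal primes. The avoidance lemma allows two
    -- ideals that need not be prime, and `m²` fills both places.
    have hnot : ¬ ((maximalIdeal R : Set R) ⊆ ((maximalIdeal R ^ 2 : Ideal R) : Set R) ∪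
        ((maximalIdeal R ^ 2 : Ideal R) : Set R) ∪
          ⋃ P ∈ (hfin.toFinset : Set (Ideal R)), (P : Set R)) := by
      intro hsub
      have hsub' := (Ideal.subset_union_prime' (s := hfin.toFinset) (f := id)
        (a := maximalIdeal R ^ 2) (b := maximalIdeal R ^ 2)
        (fun P hP => ((hfin.mem_toFinset).1 hP).1.1)).1 hsub
      have hsq : ¬ maximalIdeal R ≤ maximalIdeal R ^ 2 := by
        intro hle
        refine hmbot (Submodule.eq_bot_of_le_smul_of_le_jacobson_bot (maximalIdeal R) _
          (IsNoetherian.noetherian _) ?_ (IsLocalRing.maximalIdeal_le_jacobson _))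
        rwa [smul_eq_mul, ← pow_two]
      rcases hsub' with hle | hle | ⟨P, hP, hle⟩
      · exact hsq hle
      · exact hsq hle
      · have hPm := (hfin.mem_toFinset).1 hP
        have hP' : P.IsPrime := hPm.1.1
        have heq : P = maximalIdeal R := le_antisymm (IsLocalRing.le_maximalIdeal hP'.ne_top) hle
        have hht : (maximalIdeal R).height = 0 := by
          rw [← heq]
          exact Ideal.height_eq_zero_iff.2 hPm
        rw [← IsLocalRing.maximalIdeal_height_eq_ringKrullDim, hht] at hdim
        norm_cast at hdim
    obtain ⟨x, hx, hxn⟩ := Set.not_subset.1 hnot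
    simp only [Set.union_self, Set.mem_union, SetLike.mem_coe, Set.mem_iUnion, not_or, not_exists,
      Set.Finite.coe_toFinset] at hxn
    obtain ⟨hx2, hxP⟩ := hxn
    have hxne : Ideal.span {x} ≠ ⊤ := by
      rw [Ne, Ideal.span_singleton_eq_top]
      exact hx
    have : Nontrivial (R ⧸ Ideal.span {x}) := Ideal.Quotient.nontrivial_iff.2 hxne
    have : IsLocalRing (R ⧸ Ideal.span {x}) :=
      .of_surjective' (Ideal.Quotient.mk _) Ideal.Quotient.mk_surjective
    have hle := IsLocalRing.spanFinrank_maximalIdeal_quotient_lt hx hx2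
    rw [h, Nat.add_le_add_iff_right] at hle
    have hdim' : ringKrullDim R ≤ ringKrullDim (R ⧸ Ideal.span {x}) + 1 := by
      rw [ringKrullDim_eq_of_ringEquiv (Ideal.quotientEquivAlgOfEq R (show
        Ideal.span {x} = x • (⊤ : Ideal R) by
          simp [← Submodule.ideal_span_singleton_smul])).toRingEquiv]
      exact ringKrullDim_le_ringKrullDim_quotSMulTop_succ hx
    have hd : (d : WithBot ℕ∞) ≤ ringKrullDim (R ⧸ Ideal.span {x}) := by
      rw [← hdim, Nat.cast_add, Nat.cast_one] at hdim'
      exact (ENat.WithBot.add_le_add_one_right_iff).1 hdim'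
    have hreg : IsRegularLocalRing (R ⧸ Ideal.span {x}) :=
      .of_spanFinrank_maximalIdeal_le _ (le_trans (by exact_mod_cast hle) hd)
    have hrank : (maximalIdeal (R ⧸ Ideal.span {x})).spanFinrank = d := by
      apply le_antisymm hle
      rw [← IsRegularLocalRing.spanFinrank_maximalIdeal] at hd
      exact_mod_cast hd
    obtain ⟨hdom, rs, hrs, hmem, hlen⟩ := ih (R ⧸ Ideal.span {x}) hrank
    have hxprime : (Ideal.span {x}).IsPrime := (Ideal.Quotient.isDomain_iff_prime _).1 hdom
    have hR : IsDomain R := by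
      -- A minimal prime `P` inside the prime `(x)` does not contain `x`, so `P = x P`, and Nakayama
      -- gives `P = 0`.
      obtain ⟨P, hP, hPx⟩ := Ideal.exists_minimalPrimes_le (bot_le (a := Ideal.span {x}))
      have hP' : P.IsPrime := hP.1.1
      have : P = ⊥ := by
        refine Submodule.eq_bot_of_le_smul_of_le_jacobson_bot (maximalIdeal R) _
          (IsNoetherian.noetherian _) ?_ (IsLocalRing.maximalIdeal_le_jacobson _)
        intro y hy
        obtain ⟨z, rfl⟩ := Ideal.mem_span_singleton.1 (hPx hy)
        exact Submodule.smul_mem_smul hx ((hP'.mem_or_mem hy).resolve_left (hxP P hP))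
      rw [this] at hP'
      exact IsDomain.of_bot_isPrime R
    refine ⟨hR, ?_⟩
    obtain ⟨ts, rfl⟩ := List.map_surjective_iff.2
      (Ideal.Quotient.mk_surjective (I := Ideal.span {x})) rs
    refine ⟨x :: ts, ?_, ?_, by simpa using hlen⟩
    · rw [isWeaklyRegular_cons_iff]
      constructor
      · have hx0 : x ≠ 0 := fun h0 => hx2 (h0 ▸ zero_mem _)
        exact (IsRegular.of_ne_zero hx0).left.isSMulRegular
      · have h1 : IsWeaklyRegular (R ⧸ Ideal.span {x}) ts :=
          (isWeaklyRegular_map_algebraMap_iff (R ⧸ Ideal.span {x}) (R ⧸ Ideal.span {x}) ts).1 hrs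
        refine (LinearEquiv.isWeaklyRegular_congr ?_ ts).1 h1
        exact Submodule.quotEquivOfEq _ _ (by simp [← Submodule.ideal_span_singleton_smul])
    · intro y hy
      rcases List.mem_cons.1 hy with rfl | hy
      · exact hx
      · have := hmem _ (List.mem_map_of_mem hy)
        rw [mem_maximalIdeal, mem_nonunits_iff] at this ⊢
        exact fun hu => this (hu.map _)

theorem IsRegularLocalRing.isCohenMacaulayRing (R : Type*) [CommRing R] [IsRegularLocalRing R] :
    IsCohenMacaulayRing R := by
  refine ⟨inferInstance, fun m hm => ?_⟩
  obtain rfl := IsLocalRing.eq_maximalIdeal hm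
  let e : R ≃ₐ[R] Localization.AtPrime (maximalIdeal R) :=
    IsLocalization.atUnits R (maximalIdeal R).primeCompl (fun x => by simpa using! fun a => a)
  have := IsRegularLocalRing.of_ringEquiv e.toRingEquiv
  obtain ⟨-, rs, hrs, hmem, hlen⟩ := IsRegularLocalRing.isDomain_and_exists_isWeaklyRegular _
    (Localization.AtPrime (maximalIdeal R)) rfl
  refine localRingDepth_eq_ringKrullDim_of_isWeaklyRegular hrs hmem ?_
  rw [hlen, IsRegularLocalRing.spanFinrank_maximalIdeal]

end CohenMacaulay

/-! ### Traces in radical extensions. -/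

/-- If `y / γ` is integral, where a power of `γ` lies in the base field, then so is
`Tr y / γ`. -/
theorem isIntegral_trace_div {S L K Ω : Type*} [CommRing S] [Field L] [Field K] [Field Ω]
    [Algebra S L] [Algebra L K] [Algebra S K] [IsScalarTower S L K] [Algebra K Ω] [Algebra L Ω]
    [Algebra S Ω] [IsScalarTower L K Ω] [IsScalarTower S K Ω] [IsScalarTower S L Ω] [IsAlgClosed Ω]
    [FiniteDimensional L K] [Algebra.IsSeparable L K] {γ : Ω} {D : ℕ} (hD : D ≠ 0) {a : L}
    (hγ : γ ^ D = algebraMap L Ω a) {y : K} (hy : IsIntegral S (algebraMap K Ω y / γ)) :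
    IsIntegral S (algebraMap L Ω (Algebra.trace L K y) / γ) := by
  have key : IsIntegral S (y ^ D / algebraMap L K a) := by
    have h := hy.pow D
    rw [div_pow, hγ, IsScalarTower.algebraMap_apply L K Ω, ← map_pow, ← map_div₀] at h
    exact (isIntegral_algebraMap_iff (algebraMap K Ω).injective).1 h
  -- Conjugation fixes `a`, so each conjugate of `y ^ D / a` is integral. It is the `D`-th power of
  -- the conjugate of `y` divided by the same `γ`.
  rw [trace_eq_sum_embeddings Ω, Finset.sum_div]
  refine IsIntegral.sum _ fun σ _ => IsIntegral.of_pow (Nat.pos_of_ne_zero hD) ?_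
  have h := key.map (σ.restrictScalars S)
  rw [AlgHom.restrictScalars_apply, map_div₀, map_pow, AlgHom.commutes] at h
  rwa [div_pow, hγ]

section Radical

variable {ι : Type*} [Fintype ι]

/-- The reduced exponent vector, as an index of the monomial basis. -/
def expMod {n : ι → ℕ} (hn : ∀ i, n i ≠ 0) (a : ι → ℕ) : ∀ i, Fin (n i) :=
  fun i => ⟨a i % n i, Nat.mod_lt _ (Nat.pos_of_ne_zero (hn i))⟩

theorem prod_pow_eq_smul_prod_pow_expMod {L K : Type*} [Field L] [Field K] [Algebra L K]
    {n : ι → ℕ} (hn : ∀ i, n i ≠ 0) {f : ι → L} {ω : ι → K}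
    (hω : ∀ i, ω i ^ n i = algebraMap L K (f i)) (a : ι → ℕ) :
    ∏ i, ω i ^ a i = (∏ i, f i ^ (a i / n i)) • ∏ i, ω i ^ (expMod hn a i : ℕ) := by
  rw [Algebra.smul_def, map_prod, ← Finset.prod_mul_distrib]
  refine Finset.prod_congr rfl fun i _ => ?_
  rw [map_pow, ← hω, ← pow_mul, ← pow_add]
  exact congrArg _ (Nat.div_add_mod _ _).symm

/-- The trace of a monomial in radicals, when the reduced monomials form a basis. -/
theorem trace_prod_pow {L K : Type*} [Field L] [Field K] [Algebra L K]
    {n : ι → ℕ} (hn : ∀ i, n i ≠ 0) {f : ι → L} {ω : ι → K}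
    (hω : ∀ i, ω i ^ n i = algebraMap L K (f i)) (B : Module.Basis (∀ i, Fin (n i)) L K)
    (hB : ∀ m, B m = ∏ i, ω i ^ (m i : ℕ)) (a : ι → ℕ) [Decidable (∀ i, n i ∣ a i)] :
    Algebra.trace L K (∏ i, ω i ^ a i) =
      if ∀ i, n i ∣ a i then (∏ i, (n i : L)) * ∏ i, f i ^ (a i / n i) else 0 := by
  classical
  rw [Algebra.trace_eq_matrix_trace B, Matrix.trace]
  have hdiag : ∀ m, (Algebra.leftMulMatrix B (∏ i, ω i ^ a i)).diag m =
      if ∀ i, n i ∣ a i then ∏ i, f i ^ (a i / n i) else 0 := by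
    intro m
    rw [Matrix.diag_apply, Algebra.leftMulMatrix_eq_repr_mul, hB, ← Finset.prod_mul_distrib]
    simp_rw [← pow_add]
    rw [prod_pow_eq_smul_prod_pow_expMod hn hω (fun i => a i + m i), ← hB, map_smul,
      B.repr_self, Finsupp.smul_apply, Finsupp.single_apply, smul_eq_mul, mul_ite, mul_one,
      mul_zero]
    have hiff : expMod hn (fun i => a i + m i) = m ↔ ∀ i, n i ∣ a i := by
      rw [funext_iff]
      refine forall_congr' fun i => ?_
      rw [Fin.ext_iff]
      change (a i + m i) % n i = m i ↔ _
      have hmod : (a i + m i) % n i = m i ↔ a i + m i ≡ 0 + m i [MOD n i] := by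
        rw [zero_add, Nat.ModEq, Nat.mod_eq_of_lt (m i).2]
      rw [hmod, ← Nat.modEq_zero_iff_dvd]
      exact ⟨fun h => Nat.ModEq.add_right_cancel' _ h, fun h => h.add_right _⟩
    simp only [hiff]
    split_ifs with h
    · refine Finset.prod_congr rfl fun i _ => ?_
      congr 1
      obtain ⟨k, hk⟩ := h i
      rw [hk, Nat.mul_add_div (Nat.pos_of_ne_zero (hn i)),
        Nat.mul_div_cancel_left _ (Nat.pos_of_ne_zero (hn i)), Nat.div_eq_of_lt (m i).2, add_zero]
    · rfl
  simp_rw [hdiag]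
  split_ifs with h
  · rw [Finset.sum_const, Finset.card_univ, Fintype.card_pi, nsmul_eq_mul]
    simp
  · simp

open Polynomial in
/-- The trace of a product of polynomials without constant term and of degree less than `2 n i`
in the radicals `ω i`. -/
theorem trace_prod_aeval {S L K : Type*} [CommRing S] [Field L] [Field K] [Algebra L K]
    [Algebra S L] [Algebra S K] [IsScalarTower S L K]
    {n : ι → ℕ} (hn : ∀ i, n i ≠ 0) {f : ι → L} {ω : ι → K}
    (hω : ∀ i, ω i ^ n i = algebraMap L K (f i)) (B : Module.Basis (∀ i, Fin (n i)) L K)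
    (hB : ∀ m, B m = ∏ i, ω i ^ (m i : ℕ)) (G : ι → S[X]) (hG : ∀ i, (G i).natDegree < 2 * n i)
    (hG0 : ∀ i, (G i).coeff 0 = 0) :
    Algebra.trace L K (∏ i, aeval (ω i) (G i)) =
      (∏ i, (n i : L)) * (∏ i, f i) * ∏ i, algebraMap S L ((G i).coeff (n i)) := by
  classical
  simp_rw [fun i => aeval_eq_sum_range' (hG i) (ω i)]
  rw [Finset.prod_univ_sum, map_sum]
  have hterm : ∀ a : ι → ℕ, ∏ i, (G i).coeff (a i) • ω i ^ a i =
      (∏ i, algebraMap S L ((G i).coeff (a i))) • ∏ i, ω i ^ a i := by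
    intro a
    rw [Algebra.smul_def, map_prod, ← Finset.prod_mul_distrib]
    refine Finset.prod_congr rfl fun i _ => ?_
    rw [Algebra.smul_def, IsScalarTower.algebraMap_apply S L K]
  simp_rw [hterm, map_smul]
  -- The only multiples of `n i` below `2 * n i` are `0` and `n i`, and exponent `0` is excluded by
  -- the vanishing constant terms.
  rw [Finset.sum_eq_single n]
  · rw [trace_prod_pow hn hω B hB, if_pos fun i => dvd_rfl, smul_eq_mul]
    simp_rw [fun i => Nat.div_self (Nat.pos_of_ne_zero (hn i)), pow_one]
    ring
  · intro a ha han
    obtain ⟨i, hi⟩ := Function.ne_iff.1 han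
    have hai : a i < 2 * n i := Finset.mem_range.1 (Fintype.mem_piFinset.1 ha i)
    by_cases h0 : a i = 0
    · rw [Finset.prod_eq_zero (Finset.mem_univ i), zero_smul]
      rw [h0, hG0, map_zero]
    · rw [trace_prod_pow hn hω B hB, if_neg, smul_zero]
      intro hdvd
      obtain ⟨k, hk⟩ := hdvd i
      have hk2 : k < 2 := by
        rw [hk, mul_comm] at hai
        exact lt_of_mul_lt_mul_right hai (Nat.zero_le _)
      interval_cases k
      · exact h0 hk
      · exact hi (by rw [hk, mul_one])
  · intro h
    refine absurd (Fintype.mem_piFinset.2 fun i => Finset.mem_range.2 ?_) h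
    have := Nat.pos_of_ne_zero (hn i)
    omega

theorem span_range_prod_pow_eq_top {L K : Type*} [Field L] [Field K] [Algebra L K]
    {n : ι → ℕ} (hn : ∀ i, n i ≠ 0) {f : ι → L} {ω : ι → K}
    (hω : ∀ i, ω i ^ n i = algebraMap L K (f i))
    (hK : IntermediateField.adjoin L (Set.range ω) = ⊤) :
    Submodule.span L (Set.range fun m : ∀ i, Fin (n i) => ∏ i, ω i ^ (m i : ℕ)) = ⊤ := by
  have hint : ∀ x ∈ Set.range ω, IsAlgebraic L x := by
    rintro _ ⟨i, rfl⟩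
    refine (IsIntegral.of_pow (Nat.pos_of_ne_zero (hn i)) ?_).isAlgebraic
    rw [hω]
    exact isIntegral_algebraMap
  have hadj : Algebra.adjoin L (Set.range ω) = ⊤ := by
    rw [← IntermediateField.adjoin_toSubalgebra_of_isAlgebraic hint, hK]
    rfl
  rw [eq_top_iff, ← Algebra.top_toSubmodule, ← hadj, Algebra.adjoin_eq_span, Submodule.span_le]
  intro x hx
  have : ∃ a : ι → ℕ, x = ∏ i, ω i ^ a i := by
    classical
    induction hx using Submonoid.closure_induction with
    | mem x hx =>
      obtain ⟨i, rfl⟩ := hx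
      refine ⟨Pi.single i 1, ?_⟩
      rw [Finset.prod_eq_single i] <;> simp +contextual
    | one => exact ⟨0, by simp⟩
    | mul x y _ _ hx hy =>
      obtain ⟨a, rfl⟩ := hx
      obtain ⟨b, rfl⟩ := hy
      exact ⟨a + b, by simp [pow_add, Finset.prod_mul_distrib]⟩
  obtain ⟨a, rfl⟩ := this
  rw [prod_pow_eq_smul_prod_pow_expMod hn hω a]
  exact Submodule.smul_mem _ _ (Submodule.subset_span ⟨_, rfl⟩)

end Radical

/-! ### Linear independence of the monomials in the radicals. -/

/-- In a normal domain, divisibility can be tested in an extension field, with integral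
quotients. -/
theorem dvd_of_algebraMap_eq_mul_isIntegral {S E : Type*} [CommRing S] [IsDomain S]
    [IsIntegrallyClosed S] [Field E] [Algebra S E] [FaithfulSMul S E] {g x : S} {w : E}
    (hw : IsIntegral S w) (h : algebraMap S E x = algebraMap S E g * w) : g ∣ x := by
  have hinj := FaithfulSMul.algebraMap_injective S E
  by_cases hg : g = 0
  · rw [hg, map_zero, zero_mul, map_eq_zero_iff _ hinj] at h
    rw [hg, h]
  let _ : Algebra (FractionRing S) E := FractionRing.liftAlgebra S E
  have hgL : algebraMap S (FractionRing S) g ≠ 0 := by simpa using hg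
  have hgE : algebraMap S E g ≠ 0 := by rwa [Ne, map_eq_zero_iff _ hinj]
  have hw' : w = algebraMap (FractionRing S) E
      (algebraMap S (FractionRing S) x / algebraMap S (FractionRing S) g) := by
    rw [map_div₀, ← IsScalarTower.algebraMap_apply, ← IsScalarTower.algebraMap_apply, h,
      mul_div_cancel_left₀ _ hgE]
  rw [hw', isIntegral_algebraMap_iff (algebraMap (FractionRing S) E).injective,
    IsIntegrallyClosed.isIntegral_iff] at hw
  obtain ⟨z, hz⟩ := hw
  refine ⟨z, ?_⟩
  rw [eq_div_iff hgL, ← map_mul] at hz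
  rw [← IsFractionRing.injective S (FractionRing S) hz, mul_comm]

open Polynomial in
/-- Irreducibility of `X ^ n - a` in terms of constant coefficients of possible factors. -/
theorem irreducible_X_pow_sub_C_of_forall_pow_ne {E : Type*} [Field E] {n : ℕ} (hn : n ≠ 0) {a : E}
    (h : ∀ (c : E) (s : ℕ), 0 < s → s < n → c ^ (2 * n) ≠ a ^ (2 * s)) :
    Irreducible (X ^ n - C a) := by
  have hmonic := monic_X_pow_sub_C a hn
  have hdeg : (X ^ n - C a).natDegree = n := natDegree_X_pow_sub_C
  rw [hmonic.irreducible_iff_lt_natDegree_lt fun h1 => hn (by rw [← hdeg, h1, natDegree_one]),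
    hdeg]
  intro q hq hqdeg hdvd
  rw [Finset.mem_Ioc] at hqdeg
  refine h (q.coeff 0) q.natDegree hqdeg.1 (by omega) ?_
  let Ω := AlgebraicClosure E
  apply (algebraMap E Ω).injective
  have hsplit : (q.map (algebraMap E Ω)).Splits := IsAlgClosed.splits _
  have hcoeff := hsplit.coeff_zero_eq_prod_roots_of_monic (hq.map _)
  rw [coeff_map, natDegree_map] at hcoeff
  -- The constant coefficient is, up to sign, a product of `n`-th roots of `a`. The even exponent `2
  -- * n` removes the sign.
  have hroots : ∀ x ∈ (q.map (algebraMap E Ω)).roots, x ^ (2 * n) = algebraMap E Ω a ^ 2 := by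
    intro x hx
    have h1 := (mem_roots (hq.map _).ne_zero).1 hx
    have h2 : aeval x (X ^ n - C a) = 0 := by
      obtain ⟨q', hq'⟩ := hdvd
      rw [hq', map_mul]
      rw [IsRoot, eval_map_algebraMap] at h1
      rw [h1, zero_mul]
    rw [map_sub, map_pow, aeval_X, aeval_C, sub_eq_zero] at h2
    rw [mul_comm, pow_mul, h2]
  have hprod : (q.map (algebraMap E Ω)).roots.prod ^ (2 * n) =
      ((q.map (algebraMap E Ω)).roots.map (· ^ (2 * n))).prod := by
    rw [Multiset.prod_map_pow, Multiset.map_id']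
  rw [map_pow, hcoeff, mul_pow, ← pow_mul, mul_comm q.natDegree, mul_assoc, pow_mul, neg_one_sq,
    one_pow, one_mul, hprod, Multiset.map_congr rfl hroots, Multiset.map_const',
    Multiset.prod_replicate, hsplit.natDegree_eq_card_roots.symm.trans
      (natDegree_map (algebraMap E Ω)), ← pow_mul, map_pow]

section Radical

variable {ι : Type*} [Fintype ι]

/-- The complementary monomial turns the `m`-th term into a multiple of `∏ f i`. In the other terms
the exponents lie strictly between `0` and `2 * n i` and are not all equal to `n i`, so the trace
vanishes. -/
theorem trace_mul_prod_pow_sub {L K : Type*} [Field L] [Field K] [Algebra L K]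
    {n : ι → ℕ} (hn : ∀ i, n i ≠ 0) {f : ι → L} {ω : ι → K}
    (hω : ∀ i, ω i ^ n i = algebraMap L K (f i)) (B : Module.Basis (∀ i, Fin (n i)) L K)
    (hB : ∀ m, B m = ∏ i, ω i ^ (m i : ℕ)) (c : K) (m : ∀ i, Fin (n i)) :
    Algebra.trace L K (c * ∏ i, ω i ^ (n i - m i)) =
      (∏ i, (n i : L)) * (∏ i, f i) * B.repr c m := by
  classical
  conv_lhs => rw [← B.sum_repr c]
  rw [Finset.sum_mul, map_sum, Finset.sum_eq_single m]
  · rw [smul_mul_assoc, map_smul, hB, ← Finset.prod_mul_distrib]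
    simp_rw [← pow_add, fun i => Nat.add_sub_cancel' (m i).2.le]
    rw [trace_prod_pow hn hω B hB, if_pos fun i => dvd_rfl, smul_eq_mul]
    simp_rw [fun i => Nat.div_self (Nat.pos_of_ne_zero (hn i)), pow_one]
    ring
  · intro m' _ hm'
    rw [smul_mul_assoc, map_smul, hB, ← Finset.prod_mul_distrib]
    simp_rw [← pow_add]
    rw [trace_prod_pow hn hω B hB, if_neg, smul_zero]
    intro hdvd
    apply hm'
    ext i
    obtain ⟨k, hk⟩ := hdvd i
    have h1 := (m i).2
    have h2 := (m' i).2
    have hk2 : k < 2 := by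
      by_contra hk2
      have : n i * 2 ≤ n i * k := Nat.mul_le_mul_left _ (by omega)
      omega
    interval_cases k <;> omega
  · simp

/-- Here `c` acts as the fractional power `g ^ (s / M)`. Up to the factor `∏ n i * ∏ f i`, its
coordinates are traces of elements `y` having a power in `g * S`. Since `Tr y / y` is integral, `g`
divides a power of `Tr y`, hence `Tr y` itself. So that factor times `c` is an integral multiple of
`g`, although `c` carries only a proper fractional power of `g`. -/
theorem dvd_prod_pow_of_pow_eq {S L E : Type*} [CommRing S] [IsDomain S] [IsIntegrallyClosed S]
    [Field L] [CharZero L] [Field E] [Algebra S L] [IsFractionRing S L] [Algebra L E] [Algebra S E]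
    [IsScalarTower S L E] {n : ι → ℕ} (hn : ∀ i, n i ≠ 0) {f : ι → S} (hf : ∀ i, f i ≠ 0)
    {ω : ι → E} (hω : ∀ i, ω i ^ n i = algebraMap S E (f i))
    (B : Module.Basis (∀ i, Fin (n i)) L E) (hB : ∀ m, B m = ∏ i, ω i ^ (m i : ℕ)) {g : S}
    (hg : g ≠ 0) (hrad : ∀ (x : S) (D : ℕ), g ∣ x ^ D → g ∣ x) {c : E} {M s : ℕ} (hs : 0 < s)
    (hsM : s < M) (hc : c ^ M = algebraMap S E g ^ s) :
    g ∣ ((∏ i, (n i : S)) * ∏ i, f i) ^ M := by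
  classical
  have hfd : FiniteDimensional L E := B.finiteDimensional_of_finite
  have hSL := IsFractionRing.injective S L
  have hSE : Function.Injective (algebraMap S E) := by
    rw [IsScalarTower.algebraMap_eq S L E]
    exact (algebraMap L E).injective.comp hSL
  have hfaith : FaithfulSMul S E := (faithfulSMul_iff_algebraMap_injective S E).2 hSE
  let Ω := AlgebraicClosure E
  have hfaithΩ : FaithfulSMul S Ω := by
    rw [faithfulSMul_iff_algebraMap_injective, IsScalarTower.algebraMap_eq S E Ω]
    exact (algebraMap E Ω).injective.comp hSE
  have hM : M ≠ 0 := by omega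
  have hcint : IsIntegral S c := IsIntegral.of_pow (Nat.pos_of_ne_zero hM) <| by
    rw [hc, ← map_pow]
    exact isIntegral_algebraMap
  have hωint : ∀ i, IsIntegral S (ω i) := fun i =>
    IsIntegral.of_pow (Nat.pos_of_ne_zero (hn i)) <| by
      rw [hω]
      exact isIntegral_algebraMap
  have hc0 : c ≠ 0 := by
    rintro rfl
    rw [zero_pow hM] at hc
    exact pow_ne_zero s ((map_ne_zero_iff _ hSE).2 hg) hc.symm
  have hω0 : ∀ i, ω i ≠ 0 := fun i h0 => by
    have := hω i
    rw [h0, zero_pow (hn i)] at this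
    exact (map_ne_zero_iff _ hSE).2 (hf i) this.symm
  have hωL : ∀ i, ω i ^ n i = algebraMap L E (algebraMap S L (f i)) := fun i => by
    rw [hω, IsScalarTower.algebraMap_apply S L E]
  let D := M * ∏ i, n i
  have hD : D ≠ 0 := mul_ne_zero hM (Finset.prod_ne_zero_iff.2 fun i _ => hn i)
  have hpow : ∀ k : ι → ℕ, ∃ b : S, (c * ∏ i, ω i ^ k i) ^ D = algebraMap S E (g * b) := by
    intro k
    have hcD : c ^ D = algebraMap S E (g ^ (s * ∏ i, n i)) := by
      rw [pow_mul, hc, ← map_pow, ← map_pow, ← pow_mul]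
    have hωD : ∀ i, ∃ b : S, (ω i ^ k i) ^ D = algebraMap S E b := by
      intro i
      obtain ⟨e, he⟩ := (Finset.dvd_prod_of_mem n (Finset.mem_univ i)).mul_left M
      refine ⟨f i ^ (e * k i), ?_⟩
      rw [← pow_mul, mul_comm, show D = n i * e from he, mul_assoc, pow_mul, hω, ← map_pow]
    choose b hb using hωD
    have hg' : g ∣ g ^ (s * ∏ i, n i) :=
      dvd_pow_self _ (mul_ne_zero hs.ne' (Finset.prod_ne_zero_iff.2 fun i _ => hn i))
    obtain ⟨g', hg'⟩ := hg'
    refine ⟨g' * ∏ i, b i, ?_⟩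
    rw [mul_pow, hcD, hg', ← Finset.prod_pow, Finset.prod_congr rfl fun i _ => hb i, ← map_prod,
      ← map_mul, mul_assoc]
  have hcoord : ∀ m : ∀ i, Fin (n i), ∃ z : S,
      (∏ i, (n i : L)) * (∏ i, algebraMap S L (f i)) * B.repr c m =
        algebraMap S L g * algebraMap S L z := by
    intro m
    rw [← trace_mul_prod_pow_sub hn hωL B hB c m]
    set y := c * ∏ i, ω i ^ (n i - m i) with hy
    have hyint : IsIntegral S y :=
      hcint.mul (IsIntegral.prod _ fun i _ => (hωint i).pow _)
    have hy0 : y ≠ 0 :=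
      mul_ne_zero hc0 (Finset.prod_ne_zero_iff.2 fun i _ => pow_ne_zero _ (hω0 i))
    have hy0' : algebraMap E Ω y ≠ 0 := (map_ne_zero _).2 hy0
    obtain ⟨b, hb⟩ := hpow fun i => n i - m i
    have hα : IsIntegral S (algebraMap L Ω (Algebra.trace L E y) / algebraMap E Ω y) := by
      refine isIntegral_trace_div hD (a := algebraMap S L (g * b)) ?_ ?_
      · rw [← map_pow, hb, ← IsScalarTower.algebraMap_apply, ← IsScalarTower.algebraMap_apply]
      · rw [div_self hy0']
        exact isIntegral_one
    have hTr : IsIntegral S (Algebra.trace L E y) := by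
      have : IsIntegral S (algebraMap L Ω (Algebra.trace L E y)) := by
        rw [← div_mul_cancel₀ (algebraMap L Ω (Algebra.trace L E y)) hy0']
        exact hα.mul hyint.algebraMap
      exact (isIntegral_algebraMap_iff (algebraMap L Ω).injective).1 this
    obtain ⟨x, hx⟩ := IsIntegrallyClosed.isIntegral_iff.1 hTr
    have hdvd : g ∣ x := by
      refine hrad x D (dvd_of_algebraMap_eq_mul_isIntegral (E := Ω)
        ((hα.pow D).mul (isIntegral_algebraMap (x := b))) ?_)
      have hyD : algebraMap E Ω y ^ D = algebraMap S Ω g * algebraMap S Ω b := by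
        rw [← map_pow, hb, ← IsScalarTower.algebraMap_apply, map_mul]
      rw [map_pow, IsScalarTower.algebraMap_apply S L Ω, hx, mul_left_comm, ← hyD, ← mul_pow,
        div_mul_cancel₀ _ hy0']
    obtain ⟨z, rfl⟩ := hdvd
    exact ⟨z, by rw [← hx, map_mul]⟩
  choose z hz using hcoord
  have hw : IsIntegral S (∑ m, algebraMap S E (z m) * B m) :=
    IsIntegral.sum _ fun m _ => isIntegral_algebraMap.mul <| by
      rw [hB]
      exact IsIntegral.prod _ fun i _ => (hωint i).pow _
  have hNc : algebraMap S E ((∏ i, (n i : S)) * ∏ i, f i) * c =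
      algebraMap S E g * ∑ m, algebraMap S E (z m) * B m := by
    conv_lhs => rw [← B.sum_repr c]
    rw [Finset.mul_sum, Finset.mul_sum]
    refine Finset.sum_congr rfl fun m _ => ?_
    have h1 := congrArg (algebraMap L E) (hz m)
    simp only [map_mul, map_prod, map_natCast, ← IsScalarTower.algebraMap_apply] at h1 ⊢
    rw [Algebra.smul_def, ← mul_assoc, h1, mul_assoc]
  -- In the `M`-th power of `hNc`, cancelling `g ^ s` from `g ^ M` leaves `g ^ (k + 1)`, so at least
  -- one factor `g` survives.
  obtain ⟨k, rfl⟩ : ∃ k, M = s + 1 + k := ⟨M - s - 1, by omega⟩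
  refine dvd_of_algebraMap_eq_mul_isIntegral (E := E)
    (((isIntegral_algebraMap (x := g)).pow k).mul (hw.pow (s + 1 + k))) ?_
  have h2 := congrArg (· ^ (s + 1 + k)) hNc
  simp only [mul_pow, hc] at h2
  refine mul_right_cancel₀ (pow_ne_zero s ((map_ne_zero_iff _ hSE).2 hg)) ?_
  rw [map_pow, h2]
  ring

/-- Induction on the number of radicals: adjoining `ω 0` last, its minimal polynomial is shown to be
`X ^ n 0 - f 0`. A proper factor would force `f 0` to divide a power of the product of the other `f
j` and `n j`, which the prime `Q` attached to `f 0` forbids. -/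
theorem linearIndependent_prod_pow {S : Type*} {L : Type*} [CommRing S] [IsDomain S]
    [IsIntegrallyClosed S] [Field L] [CharZero L] [Algebra S L] [IsFractionRing S L] (r : ℕ) :
    ∀ {K : Type*} [Field K] [Algebra L K] [Algebra S K] [IsScalarTower S L K] {n : Fin r → ℕ}
      (_ : ∀ i, n i ≠ 0) {f : Fin r → S} (_ : ∀ i, f i ≠ 0)
      (_ : ∀ (i : Fin r) (x : S) (D : ℕ), f i ∣ x ^ D → f i ∣ x)
      (_ : ∀ i, ∃ Q : Ideal S, Q.IsPrime ∧ f i ∈ Q ∧ (∀ j, (n j : S) ∉ Q) ∧ ∀ j, j ≠ i → f j ∉ Q)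
      {ω : Fin r → K} (_ : ∀ i, ω i ^ n i = algebraMap S K (f i)),
      LinearIndependent L fun m : ∀ i, Fin (n i) => ∏ i, ω i ^ (m i : ℕ) := by
  induction r with
  | zero =>
    intro K _ _ _ _ n hn f hf hrad hQ ω hω
    rw [linearIndependent_unique_iff]
    simp
  | succ r ih =>
    intro K _ _ _ _ n hn f hf hrad hQ ω hω
    let E := IntermediateField.adjoin L (Set.range fun i : Fin r => ω i.succ)
    let ω' : Fin r → E := fun i =>
      ⟨ω i.succ, IntermediateField.subset_adjoin L _ (Set.mem_range_self i)⟩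
    have hω' : ∀ i, ω' i ^ n i.succ = algebraMap S E (f i.succ) := fun i => by
      apply Subtype.ext
      exact hω i.succ
    have hω'L : ∀ i, ω' i ^ n i.succ = algebraMap L E (algebraMap S L (f i.succ)) := fun i => by
      rw [hω', IsScalarTower.algebraMap_apply S L E]
    have htow : IsScalarTower S E K := IsScalarTower.of_algebraMap_eq fun x => by
      rw [IsScalarTower.algebraMap_apply S L K, IsScalarTower.algebraMap_apply S L E,
        ← IsScalarTower.algebraMap_apply L E K]
    have hadj : IntermediateField.adjoin L (Set.range ω') = ⊤ := by
      apply IntermediateField.map_injective E.val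
      rw [IntermediateField.adjoin_map, ← Set.range_comp]
      change E = IntermediateField.map E.val ⊤
      rw [← AlgHom.fieldRange_eq_map, IntermediateField.fieldRange_val]
    have hli := ih (K := E) (fun i => hn i.succ) (fun i => hf i.succ) (fun i => hrad i.succ)
      (fun i => by
        obtain ⟨Q, hQp, hfQ, hnQ, hfj⟩ := hQ i.succ
        exact ⟨Q, hQp, hfQ, fun j => hnQ _, fun j hj => hfj _ fun h => hj (Fin.succ_injective _ h)⟩)
      hω'
    have hspan := span_range_prod_pow_eq_top (fun i : Fin r => hn i.succ) hω'L hadj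
    let B : Module.Basis (∀ i : Fin r, Fin (n i.succ)) L E := Module.Basis.mk hli hspan.ge
    have hB : ∀ m, B m = ∏ i, ω' i ^ (m i : ℕ) := fun m => Module.Basis.mk_apply _ _ m
    have hirr : Irreducible (Polynomial.X ^ n 0 - Polynomial.C (algebraMap S E (f 0))) := by
      refine irreducible_X_pow_sub_C_of_forall_pow_ne (hn 0) fun c s hs hsn hc => ?_
      have hdvd := dvd_prod_pow_of_pow_eq (fun i : Fin r => hn i.succ) (fun i => hf i.succ)
        hω' B hB (hf 0)
        (hrad 0) (c := c) (M := 2 * n 0) (s := 2 * s) (by omega) (by omega) hc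
      obtain ⟨Q, hQp, hfQ, hnQ, hfj⟩ := hQ 0
      rcases hQp.mem_or_mem (hQp.mem_of_pow_mem _ (Ideal.mem_of_dvd Q hdvd hfQ)) with h | h
      · obtain ⟨j, -, hj⟩ := hQp.prod_mem_iff.1 h
        exact hnQ _ hj
      · obtain ⟨j, -, hj⟩ := hQp.prod_mem_iff.1 h
        exact hfj _ (Fin.succ_ne_zero j) hj
    have hmin : Polynomial.X ^ n 0 - Polynomial.C (algebraMap S E (f 0)) = minpoly E (ω 0) := by
      refine minpoly.eq_of_irreducible_of_monic hirr ?_ (Polynomial.monic_X_pow_sub_C _ (hn 0))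
      rw [map_sub, map_pow, Polynomial.aeval_X, Polynomial.aeval_C, hω,
        ← IsScalarTower.algebraMap_apply, sub_self]
    have hdeg : (minpoly E (ω 0)).natDegree = n 0 := by
      rw [← hmin, Polynomial.natDegree_X_pow_sub_C]
    have hli0 : LinearIndependent E fun i : Fin (n 0) => ω 0 ^ (i : ℕ) := by
      have h := linearIndependent_pow (K := E) (ω 0)
      exact h.comp (Fin.cast hdeg.symm) (Fin.cast_injective _)
    have htower := linearIndependent_smul hli hli0
    let e : (∀ i : Fin (r + 1), Fin (n i)) → (∀ i : Fin r, Fin (n i.succ)) × Fin (n 0) :=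
      fun m => (fun i => m i.succ, m 0)
    have he : Function.Injective e := by
      intro m m' h
      rw [Prod.mk.injEq] at h
      funext i
      refine Fin.cases h.2 (fun i => congrFun h.1 i) i
    convert! htower.comp e he using 2 with m
    rw [Fin.prod_univ_succ, mul_comm]
    simp only [e, ω', Function.comp_apply, Algebra.smul_def, IntermediateField.algebraMap_apply,
      SubmonoidClass.coe_finsetProd, SubmonoidClass.coe_pow]

end Radical

/-! ### Dual polynomials. -/

section DualPolynomials

open Polynomial

variable {S : Type*} [CommRing S]

/-- The polynomials `pthRootDual p h e`, for `e < p`, are dual to the powers `(X - h) ^ e` for the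
pairing that takes two polynomials to the coefficient of degree `p - 1` of their product. -/
noncomputable def pthRootDual (p : ℕ) (h : S) (e : ℕ) : S[X] :=
  ∑ k ∈ Finset.range (p - e), C ((p.choose (k + 1 + e) : S) * h ^ (p - 1 - e - k)) * (X - C h) ^ k

theorem natDegree_X_sub_C_pow [Nontrivial S] (h : S) (m : ℕ) : ((X - C h) ^ m).natDegree = m := by
  rw [(monic_X_sub_C h).natDegree_pow, natDegree_X_sub_C, mul_one]

theorem coeff_X_sub_C_pow_of_lt (h : S) {m N : ℕ} (hm : m < N) : ((X - C h) ^ m).coeff N = 0 := by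
  nontriviality S
  apply coeff_eq_zero_of_natDegree_lt
  rwa [natDegree_X_sub_C_pow]

theorem coeff_X_sub_C_pow_self (h : S) (m : ℕ) : ((X - C h) ^ m).coeff m = 1 := by
  nontriviality S
  have := ((monic_X_sub_C h).pow m).coeff_natDegree
  rwa [natDegree_X_sub_C_pow] at this

/-- This is the binomial expansion of `X ^ p` around `h`. The polynomials `pthRootDual` are the
tails of this quotient, divided by powers of `X - h`. -/
theorem X_sub_C_mul_sum_choose (p : ℕ) (h : S) :
    (X - C h) * ∑ k ∈ Finset.range p, C ((p.choose (k + 1) : S) * h ^ (p - 1 - k)) * (X - C h) ^ k =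
      X ^ p - C (h ^ p) := by
  have hadd := add_pow (X - C h) (C h) p
  rw [sub_add_cancel, Finset.sum_range_succ'] at hadd
  rw [hadd]
  simp only [pow_zero, Nat.sub_zero, one_mul, Nat.choose_zero_right, Nat.cast_one, mul_one, C_pow,
    add_sub_cancel_right, Finset.mul_sum]
  refine Finset.sum_congr rfl fun k _ => ?_
  rw [show p - (k + 1) = p - 1 - k by omega]
  simp only [C_mul, C_pow, map_natCast]
  ring

/-- For `e' ≤ e` the product has degree at most `p - 1`, attained with leading coefficient `1` only
if `e' = e`. For `e' > e` it is a multiple of `X ^ p - h ^ p` up to terms of degree below `p - 1`,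
and the `X ^ p` part does not reach degree `p - 1`. -/
theorem coeff_X_sub_C_pow_mul_pthRootDual {p : ℕ} (h : S) {e e' : ℕ} (he : e < p) (he' : e' < p) :
    ((X - C h) ^ e' * pthRootDual p h e).coeff (p - 1) = if e' = e then 1 else 0 := by
  rcases le_or_gt e' e with hle | hlt
  · rw [pthRootDual, Finset.mul_sum, finsetSum_coeff,
      show p - e = (p - 1 - e) + 1 by omega, Finset.sum_range_succ, Finset.sum_eq_zero, zero_add]
    · rw [mul_left_comm, coeff_C_mul, ← pow_add]
      split_ifs with h1
      · subst h1
        rw [show e' + (p - 1 - e') = p - 1 by omega, coeff_X_sub_C_pow_self,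
          show p - 1 - e' + 1 + e' = p by omega]
        simp
      · rw [coeff_X_sub_C_pow_of_lt, mul_zero]
        omega
    · intro k hk
      rw [Finset.mem_range] at hk
      rw [mul_left_comm, coeff_C_mul, ← pow_add, coeff_X_sub_C_pow_of_lt, mul_zero]
      omega
  · rw [if_neg hlt.ne']
    obtain ⟨l, rfl⟩ : ∃ l, e' = l + 1 + e := ⟨e' - e - 1, by omega⟩
    have hsplit : (X - C h) ^ (l + 1 + e) * pthRootDual p h e = (X - C h) ^ l * (X ^ p - C (h ^ p)) -
        ∑ k ∈ Finset.range e, C ((p.choose (k + 1) : S) * h ^ (p - 1 - k)) *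
          (X - C h) ^ (l + 1 + k) := by
      rw [← X_sub_C_mul_sum_choose, eq_sub_iff_add_eq, ← Finset.sum_range_add_sum_Ico _ he.le,
        Finset.sum_Ico_eq_sum_range, pthRootDual]
      rw [mul_add, mul_add, add_comm]
      simp only [Finset.mul_sum]
      congr 1
      · refine Finset.sum_congr rfl fun k _ => ?_
        ring
      · refine Finset.sum_congr rfl fun k _ => ?_
        rw [show e + k + 1 = k + 1 + e by ring, Nat.sub_sub (p - 1) e k]
        ring
    rw [hsplit, coeff_sub, mul_sub, coeff_sub, coeff_mul_X_pow', if_neg (by omega), mul_comm _ (C _),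
      coeff_C_mul, coeff_X_sub_C_pow_of_lt h (by omega), finsetSum_coeff, Finset.sum_eq_zero]
    · simp
    · intro k hk
      rw [Finset.mem_range] at hk
      rw [coeff_C_mul, coeff_X_sub_C_pow_of_lt h (by omega), mul_zero]

theorem natDegree_pthRootDual_le (p : ℕ) (h : S) (e : ℕ) :
    (pthRootDual p h e).natDegree ≤ p - 1 - e := by
  nontriviality S
  refine natDegree_sum_le_of_forall_le _ _ fun k hk => ?_
  rw [Finset.mem_range] at hk
  refine (natDegree_C_mul_le _ _).trans ?_
  rw [natDegree_X_sub_C_pow]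
  omega

/-- The polynomial `X ^ j * (X ^ d - h) ^ e`. -/
noncomputable def radicalPoly (d : ℕ) (h : S) (j e : ℕ) : S[X] :=
  X ^ j * expand S d ((X - C h) ^ e)

/-- The polynomials dual to `radicalPoly d h j e` for the pairing that takes two polynomials to the
coefficient of degree `p * d - 1` of their product. -/
noncomputable def radicalDualPoly (p d : ℕ) (h : S) (j e : ℕ) : S[X] :=
  X ^ (d - 1 - j) * expand S d (pthRootDual p h e)

theorem X_mul_radicalPoly_mul_radicalDualPoly (p d : ℕ) (h : S) (j e j' e' : ℕ) :
    X * (radicalPoly d h j' e' * radicalDualPoly p d h j e) =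
      expand S d ((X - C h) ^ e' * pthRootDual p h e) * X ^ (1 + j' + (d - 1 - j)) := by
  rw [radicalPoly, radicalDualPoly, map_mul]
  ring

theorem natDegree_radicalPoly_mul_lt {p d : ℕ} (hp : p ≠ 0) (h : S) {j e j' e' : ℕ}
    (hj' : j' < d) (he' : e' < p) :
    (X * (radicalPoly d h j' e' * radicalDualPoly p d h j e)).natDegree < 2 * (p * d) := by
  rcases subsingleton_or_nontrivial S with hS | hS
  · rw [natDegree_of_subsingleton]
    exact Nat.mul_pos two_pos (Nat.mul_pos (Nat.pos_of_ne_zero hp) (by omega))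
  rw [X_mul_radicalPoly_mul_radicalDualPoly]
  refine natDegree_mul_le.trans_lt ?_
  rw [natDegree_expand, natDegree_X_pow]
  have h1 : ((X - C h) ^ e' * pthRootDual p h e).natDegree ≤ (p - 1) + (p - 1) := by
    refine natDegree_mul_le.trans ?_
    rw [natDegree_X_sub_C_pow]
    have := natDegree_pthRootDual_le p h e
    omega
  have h2 := Nat.mul_le_mul_right d h1
  obtain ⟨q, rfl⟩ : ∃ q, p = q + 1 := ⟨p - 1, by omega⟩
  rw [Nat.add_sub_cancel] at h2
  have h3 : (q + q) * d = 2 * (q * d) := by ring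
  have h4 : (q + 1) * d = q * d + d := by ring
  omega

/-- Exponents in the product lie in one residue class modulo `d`, which is that of `p * d` only if
`j' = j`; then the pairing for `X ^ d` decides. The extra factor `X` moves degree `p * d - 1` to `p
* d` and removes the constant term, as the trace formula requires. -/
theorem coeff_radicalPoly_mul {p d : ℕ} (hp : 2 ≤ p) (h : S) {j e j' e' : ℕ} (hj : j < d)
    (hj' : j' < d) (he : e < p) (he' : e' < p) :
    (X * (radicalPoly d h j' e' * radicalDualPoly p d h j e)).coeff (p * d) =
      if j' = j ∧ e' = e then 1 else 0 := by
  have hd : 0 < d := by omega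
  rw [X_mul_radicalPoly_mul_radicalDualPoly, coeff_mul_X_pow']
  obtain ⟨q, rfl⟩ : ∃ q, p = q + 1 := ⟨p - 1, by omega⟩
  have h4 : (q + 1) * d = q * d + d := by ring
  have h5 : 1 * d ≤ q * d := Nat.mul_le_mul_right d (by omega)
  rw [if_pos (by omega), coeff_expand hd]
  by_cases hjj : j' = j
  · subst hjj
    have h6 : (q + 1) * d - (1 + j' + (d - 1 - j')) = q * d := by omega
    rw [h6, if_pos (dvd_mul_left d q), Nat.mul_div_cancel _ hd]
    have := coeff_X_sub_C_pow_mul_pthRootDual h he he'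
    rw [Nat.add_sub_cancel] at this
    rw [this]
    simp
  · rw [if_neg, if_neg fun h => hjj h.1]
    intro hdvd
    have h7 : d ∣ ((q + 1) * d - (1 + j' + (d - 1 - j'))) := by
      rw [show (q + 1) * d - (1 + j' + (d - 1 - j')) = q * d by omega]
      exact dvd_mul_left d q
    obtain ⟨k, hk⟩ := hdvd
    obtain ⟨k', hk'⟩ := h7
    rcases lt_trichotomy k k' with hlt | heq | hgt
    · have := Nat.mul_le_mul_left d (show k + 1 ≤ k' from hlt)
      rw [mul_add, mul_one] at this
      omega
    · subst heq
      omega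
    · have := Nat.mul_le_mul_left d (show k' + 1 ≤ k from hgt)
      rw [mul_add, mul_one] at this
      omega

theorem aeval_radicalPoly {K : Type*} [CommRing K] [Algebra S K] (d : ℕ) (h : S) (j e : ℕ) (ω : K) :
    aeval ω (radicalPoly d h j e) = ω ^ j * (ω ^ d - algebraMap S K h) ^ e := by
  simp [radicalPoly]

theorem aeval_radicalDualPoly {K : Type*} [CommRing K] [Algebra S K] (p d : ℕ) (h : S) (j e : ℕ)
    (ω : K) : aeval ω (radicalDualPoly p d h j e) =
      ω ^ (d - 1 - j) * aeval (ω ^ d) (pthRootDual p h e) := by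
  simp [radicalDualPoly, expand_aeval]

theorem aeval_pthRootDual {K : Type*} [CommRing K] [Algebra S K] (p : ℕ) (h : S) (e : ℕ) (τ : K) :
    aeval τ (pthRootDual p h e) = ∑ k ∈ Finset.range (p - e),
      (p.choose (k + 1 + e) : K) * algebraMap S K h ^ (p - 1 - e - k) *
        (τ - algebraMap S K h) ^ k := by
  simp [pthRootDual]

end DualPolynomials

/-! ### Divisibility by powers of `π`, where `π ^ (p - 1) = p`. -/

section Integrality

theorem isIntegral_of_sq_add_mul_eq {S Ω : Type*} [CommRing S] [CommRing Ω] [Algebra S Ω]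
    {x g b : Ω} (hg : IsIntegral S g) (hb : IsIntegral S b) (h : x ^ 2 + g * x = b) :
    IsIntegral S x := by
  let A := integralClosure S Ω
  have : IsIntegral A x := by
    refine ⟨Polynomial.X ^ 2 + (Polynomial.C (⟨g, hg⟩ : A) * Polynomial.X -
      Polynomial.C (⟨b, hb⟩ : A)), ?_, ?_⟩
    · refine Polynomial.monic_X_pow_add ?_
      refine (Polynomial.degree_sub_le _ _).trans_lt (max_lt ?_ ?_)
      · exact (Polynomial.degree_C_mul_X_le _).trans_lt (by norm_num)
      · exact Polynomial.degree_C_le.trans_lt (by norm_num)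
    · simp only [Polynomial.eval₂_add, Polynomial.eval₂_sub, Polynomial.eval₂_mul,
        Polynomial.eval₂_pow, Polynomial.eval₂_X, Polynomial.eval₂_C]
      change x ^ 2 + (g * x - b) = 0
      rw [← h]
      ring
  exact isIntegral_trans x this

variable {S Ω : Type*} [CommRing S] [Field Ω] [CharZero Ω] [Algebra S Ω] {p : ℕ} {a h : S} {τ π : Ω}

/-- If `τ ^ p = h ^ p + p ^ 2 * a` and `π ^ (p - 1) = p`, then `τ - h` is divisible by `π`. -/
theorem isIntegral_sub_div (hp : p.Prime)
    (hτ : τ ^ p = algebraMap S Ω h ^ p + (p : Ω) ^ 2 * algebraMap S Ω a)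
    (hπ : π ^ (p - 1) = p) : IsIntegral S ((τ - algebraMap S Ω h) / π) := by
  have hp0 : (p : Ω) ≠ 0 := Nat.cast_ne_zero.2 hp.ne_zero
  have hp2 := hp.two_le
  have hτint : IsIntegral S τ := IsIntegral.of_pow hp.pos <| by
    rw [hτ]
    exact (isIntegral_algebraMap.pow _).add (((isIntegral_natCast p).pow 2).mul isIntegral_algebraMap)
  set t := τ - algebraMap S Ω h with ht
  have htint : IsIntegral S t := hτint.sub isIntegral_algebraMap
  refine IsIntegral.of_pow (n := p - 1) (by omega) ?_
  rw [div_pow, hπ]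
  have hchoose : ∀ k ∈ Finset.range (p - 1), ∃ b : ℕ, p.choose (k + 1) = p * b := fun k hk => by
    rw [Finset.mem_range] at hk
    exact hp.dvd_choose_self (by omega) (by omega)
  let g : Ω := ∑ k ∈ Finset.range (p - 1),
    (p.choose (k + 1) : Ω) / p * algebraMap S Ω h ^ (p - 1 - k) * t ^ k
  have hg : IsIntegral S g := by
    refine IsIntegral.sum _ fun k hk => IsIntegral.mul (IsIntegral.mul ?_
      (isIntegral_algebraMap.pow _)) (htint.pow k)
    obtain ⟨b, hb⟩ := hchoose k hk
    rw [hb, Nat.cast_mul, mul_div_cancel_left₀ _ hp0]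
    exact isIntegral_natCast b
  -- The expansion of `τ ^ p - h ^ p` in powers of `t`: the middle binomial coefficients supply the
  -- factor `p`, and the congruence supplies `p ^ 2`.
  have hmain : t * (t ^ (p - 1) + p * g) = (p : Ω) ^ 2 * algebraMap S Ω a := by
    have h1 := congrArg (Polynomial.aeval τ) (X_sub_C_mul_sum_choose p h)
    rw [show p = (p - 1) + 1 by omega, Finset.sum_range_succ, ← show p = (p - 1) + 1 by omega] at h1
    simp only [map_mul, map_add, map_sub, Polynomial.aeval_X, Polynomial.aeval_C, map_sum, map_pow,
      map_natCast, hτ, ← ht, Nat.choose_self, Nat.cast_one, Nat.sub_self, pow_zero, mul_one, map_one, one_mul]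
      at h1
    rw [add_sub_cancel_left] at h1
    rw [← h1, Finset.mul_sum, add_comm]
    congr 2
    refine Finset.sum_congr rfl fun k _ => ?_
    field_simp
  -- Multiplying `hmain` by `t ^ (p - 2) / p ^ 2` gives `x ^ 2 + g * x = a * t ^ (p - 2)` for `x = t
  -- ^ (p - 1) / p`.
  refine isIntegral_of_sq_add_mul_eq hg
    ((isIntegral_algebraMap (x := a)).mul (htint.pow (p - 2))) ?_
  obtain ⟨q, rfl⟩ : ∃ q, p = q + 2 := ⟨p - 2, by omega⟩
  rw [show q + 2 - 1 = q + 1 by omega] at hmain ⊢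
  rw [show q + 2 - 2 = q by omega]
  field_simp
  linear_combination t ^ q * hmain

/-- Every coefficient but the top one is divisible by `p = π ^ (p - 1)`. The top term is `(τ - h) ^
(p - 1 - e)`, and `τ - h` is divisible by `π`. -/
theorem exists_isIntegral_aeval_pthRootDual (hp : p.Prime)
    (hτ : τ ^ p = algebraMap S Ω h ^ p + (p : Ω) ^ 2 * algebraMap S Ω a)
    (hπ : π ^ (p - 1) = p) {e : ℕ} (he : e < p) :
    ∃ B : Ω, IsIntegral S B ∧ Polynomial.aeval τ (pthRootDual p h e) = π ^ (p - 1 - e) * B := by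
  have hp2 := hp.two_le
  have hp0 : (p : Ω) ≠ 0 := Nat.cast_ne_zero.2 hp.ne_zero
  have hπ0 : π ≠ 0 := by
    rintro rfl
    rw [zero_pow (by omega)] at hπ
    exact hp0 hπ.symm
  have hπint : IsIntegral S π := IsIntegral.of_pow (n := p - 1) (by omega) <| by
    rw [hπ]
    exact isIntegral_natCast p
  have hs := isIntegral_sub_div hp hτ hπ
  set s := (τ - algebraMap S Ω h) / π with hsdef
  have hts : τ - algebraMap S Ω h = π * s := by
    rw [hsdef, mul_div_cancel₀ _ hπ0]
  rw [aeval_pthRootDual, hts, show p - e = (p - 1 - e) + 1 by omega, Finset.sum_range_succ]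
  have hchoose : ∀ k, ∃ b : ℕ, k < p - 1 - e → p.choose (k + 1 + e) = p * b := fun k => by
    by_cases hk : k < p - 1 - e
    · obtain ⟨b, hb⟩ := hp.dvd_choose_self (k := k + 1 + e) (by omega) (by omega)
      exact ⟨b, fun _ => hb⟩
    · exact ⟨0, fun h => absurd h hk⟩
  choose b hb using hchoose
  refine ⟨(∑ k ∈ Finset.range (p - 1 - e), π ^ e * b k * algebraMap S Ω h ^ (p - 1 - e - k) *
    (π * s) ^ k) + s ^ (p - 1 - e), ?_, ?_⟩
  · refine IsIntegral.add (IsIntegral.sum _ fun k _ => ?_) (hs.pow _)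
    exact (((hπint.pow e).mul (isIntegral_natCast _)).mul (isIntegral_algebraMap.pow _)).mul
      ((hπint.mul hs).pow k)
  · rw [mul_add, Finset.mul_sum]
    congr 1
    · refine Finset.sum_congr rfl fun k hk => ?_
      rw [hb k (Finset.mem_range.1 hk), Nat.cast_mul, ← hπ,
        show p - 1 = (p - 1 - e) + e by omega, Nat.add_sub_cancel, pow_add]
      ring
    · rw [show p - 1 - e + 1 + e = p by omega, Nat.choose_self, Nat.sub_self, mul_pow]
      ring

end Integrality

/-! ### The basis of the integral closure and its coordinate functions. -/

section RadicalBasis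

open Polynomial

variable {r : ℕ} {S L K : Type*} [CommRing S] [Field L] [Field K] [Algebra S L] [Algebra L K]
  [Algebra S K]

/-- The exponent of `p` in the denominator of the basis element with index `q`. -/
def radicalExponent (p : ℕ) {d : Fin r → ℕ} (q : ∀ i, Fin (d i) × Fin p) : ℕ :=
  (∑ i, ((q i).2 : ℕ)) / (p - 1)

/-- The product of the `ω i ^ j * (ω i ^ d i - h i) ^ e`, divided by a power of `p`. -/
noncomputable def radicalBasisElement (p : ℕ) {d : Fin r → ℕ} (h : Fin r → S) (ω : Fin r → K)
    (q : ∀ i, Fin (d i) × Fin p) : K :=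
  (∏ i, aeval (ω i) (radicalPoly (d i) (h i) (q i).1 (q i).2)) / (p : K) ^ radicalExponent p q

/-- The product of the dual polynomials, evaluated at the radicals. -/
noncomputable def radicalDualElement (p : ℕ) {d : Fin r → ℕ} (h : Fin r → S) (ω : Fin r → K)
    (q : ∀ i, Fin (d i) × Fin p) : K :=
  ∏ i, (ω i * aeval (ω i) (radicalDualPoly p (d i) (h i) (q i).1 (q i).2))

variable (L) in
/-- The coordinate functions with respect to `radicalBasisElement`. -/
noncomputable def radicalCoord (p : ℕ) {d : Fin r → ℕ} (f h : Fin r → S) (ω : Fin r → K)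
    (q : ∀ i, Fin (d i) × Fin p) : K →ₗ[L] L :=
  ((p : L) ^ radicalExponent p q / ((∏ i, ((p * d i : ℕ) : L)) * ∏ i, algebraMap S L (f i))) •
    (Algebra.trace L K ∘ₗ LinearMap.mulRight L (radicalDualElement p h ω q))

/-- A basis element times a dual element is a product of polynomials in the separate radicals, so
its trace is a product of coefficients, each a Kronecker delta. -/
theorem radicalCoord_radicalBasisElement [IsScalarTower S L K] [CharZero L] {p : ℕ}
    (hp : p.Prime) {d : Fin r → ℕ} (hd : ∀ i, d i ≠ 0) {f h : Fin r → S}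
    (hf : ∀ i, algebraMap S L (f i) ≠ 0) {ω : Fin r → K}
    (hω : ∀ i, ω i ^ (p * d i) = algebraMap S K (f i))
    (B : Module.Basis (∀ i, Fin (p * d i)) L K) (hB : ∀ m, B m = ∏ i, ω i ^ (m i : ℕ))
    (q q' : ∀ i, Fin (d i) × Fin p) :
    radicalCoord L p f h ω q (radicalBasisElement p h ω q') = if q' = q then 1 else 0 := by
  have hp0 : (p : L) ≠ 0 := Nat.cast_ne_zero.2 hp.ne_zero
  have hn : ∀ i, p * d i ≠ 0 := fun i => mul_ne_zero hp.ne_zero (hd i)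
  have hωL : ∀ i, ω i ^ (p * d i) = algebraMap L K (algebraMap S L (f i)) := fun i => by
    rw [hω, IsScalarTower.algebraMap_apply S L K]
  have hN : (∏ i, ((p * d i : ℕ) : L)) ≠ 0 :=
    Finset.prod_ne_zero_iff.2 fun i _ => Nat.cast_ne_zero.2 (hn i)
  have hF : (∏ i, algebraMap S L (f i)) ≠ 0 := Finset.prod_ne_zero_iff.2 fun i _ => hf i
  have hprod : radicalBasisElement p h ω q' * radicalDualElement p h ω q =
      ((p : L) ^ radicalExponent p q')⁻¹ • ∏ i, aeval (ω i)
        (X * (radicalPoly (d i) (h i) (q' i).1 (q' i).2 *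
          radicalDualPoly p (d i) (h i) (q i).1 (q i).2)) := by
    rw [radicalBasisElement, radicalDualElement, Algebra.smul_def, map_inv₀, map_pow, map_natCast,
      div_mul_eq_mul_div, ← Finset.prod_mul_distrib, div_eq_inv_mul]
    congr 1
    refine Finset.prod_congr rfl fun i _ => ?_
    rw [map_mul, map_mul, aeval_X]
    ring
  rw [radicalCoord, LinearMap.smul_apply, LinearMap.comp_apply, LinearMap.mulRight_apply, hprod,
    map_smul, trace_prod_aeval hn hωL B hB _
      (fun i => natDegree_radicalPoly_mul_lt hp.ne_zero (h i) (q' i).1.2 (q' i).2.2)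
      (fun i => by rw [mul_coeff_zero, coeff_X_zero, zero_mul])]
  simp_rw [fun i => coeff_radicalPoly_mul hp.two_le (h i) (q i).1.2 (q' i).1.2 (q i).2.2
    (q' i).2.2]
  split_ifs with heq
  · subst heq
    simp only [and_self, if_true, map_one, Finset.prod_const_one, mul_one, smul_eq_mul]
    field_simp
  · obtain ⟨i, hi⟩ := Function.ne_iff.1 heq
    have hzero : ∏ i, algebraMap S L
        (if ((q' i).1 : ℕ) = (q i).1 ∧ ((q' i).2 : ℕ) = (q i).2 then 1 else 0) = 0 := by
      refine Finset.prod_eq_zero (Finset.mem_univ i) ?_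
      rw [if_neg, map_zero]
      rintro ⟨h1, h2⟩
      exact hi (Prod.ext (Fin.ext h1) (Fin.ext h2))
    rw [hzero, mul_zero, smul_zero, smul_zero]

theorem isIntegral_radicalBasisElement {S Ω : Type*} [CommRing S] [Field Ω] [CharZero Ω]
    [Algebra S Ω] {p : ℕ} (hp : p.Prime) {d : Fin r → ℕ} {f h a : Fin r → S}
    (hfh : ∀ i, f i = h i ^ p + p ^ 2 * a i) {ω : Fin r → Ω}
    (hω : ∀ i, ω i ^ (p * d i) = algebraMap S Ω (f i)) {π : Ω} (hπ : π ^ (p - 1) = p)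
    (hωint : ∀ i, IsIntegral S (ω i)) (q : ∀ i, Fin (d i) × Fin p) :
    IsIntegral S (radicalBasisElement p h ω q) := by
  have hp2 := hp.two_le
  have hp0 : (p : Ω) ≠ 0 := Nat.cast_ne_zero.2 hp.ne_zero
  have hπ0 : π ≠ 0 := by
    rintro rfl
    rw [zero_pow (by omega)] at hπ
    exact hp0 hπ.symm
  have hπint : IsIntegral S π := IsIntegral.of_pow (n := p - 1) (by omega) <| by
    rw [hπ]
    exact isIntegral_natCast p
  have hs : ∀ i, IsIntegral S ((ω i ^ d i - algebraMap S Ω (h i)) / π) := fun i => by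
    refine isIntegral_sub_div (a := a i) hp ?_ hπ
    rw [← pow_mul, mul_comm, hω, hfh]
    simp
  have hle : (p - 1) * radicalExponent p q ≤ ∑ i, ((q i).2 : ℕ) := Nat.mul_div_le _ _
  obtain ⟨m, hm⟩ := Nat.exists_eq_add_of_le hle
  have heq : radicalBasisElement p h ω q = (∏ i, (ω i ^ ((q i).1 : ℕ) *
      ((ω i ^ d i - algebraMap S Ω (h i)) / π) ^ ((q i).2 : ℕ))) * π ^ m := by
    rw [radicalBasisElement, div_eq_iff (pow_ne_zero _ hp0), ← hπ, ← pow_mul, mul_assoc, ← pow_add,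
      add_comm m, ← hm, ← Finset.prod_pow_eq_pow_sum, ← Finset.prod_mul_distrib]
    refine Finset.prod_congr rfl fun i _ => ?_
    rw [aeval_radicalPoly, div_pow]
    field_simp
  rw [heq]
  exact (IsIntegral.prod _ fun i _ => ((hωint i).pow _).mul ((hs i).pow _)).mul (hπint.pow m)

/-- The dual factors contribute `π ^ (p - 1 - e_i)`. Rounding down in `radicalExponent` loses at
most `p - 2` powers of `π`, so one more factor `p` restores them all with a `π` to spare. This spare
`π` is essential to the radical argument for coordinates. -/
theorem exists_isIntegral_radicalDualElement {S Ω : Type*} [CommRing S] [Field Ω] [CharZero Ω]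
    [Algebra S Ω] {p : ℕ} (hp : p.Prime) {d : Fin r → ℕ} {f h a : Fin r → S}
    (hfh : ∀ i, f i = h i ^ p + p ^ 2 * a i) {ω : Fin r → Ω}
    (hω : ∀ i, ω i ^ (p * d i) = algebraMap S Ω (f i)) {π : Ω} (hπ : π ^ (p - 1) = p)
    (hωint : ∀ i, IsIntegral S (ω i)) (q : ∀ i, Fin (d i) × Fin p) :
    ∃ w : Ω, IsIntegral S w ∧ (p : Ω) ^ (radicalExponent p q + 1) * radicalDualElement p h ω q =
      p ^ r * π * (∏ i, ω i) * w := by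
  have hp2 := hp.two_le
  have hp0 : (p : Ω) ≠ 0 := Nat.cast_ne_zero.2 hp.ne_zero
  have hπ0 : π ≠ 0 := by
    rintro rfl
    rw [zero_pow (by omega)] at hπ
    exact hp0 hπ.symm
  have hπint : IsIntegral S π := IsIntegral.of_pow (n := p - 1) (by omega) <| by
    rw [hπ]
    exact isIntegral_natCast p
  have hex : ∀ i, ∃ B : Ω, IsIntegral S B ∧
      aeval (ω i ^ d i) (pthRootDual p (h i) ((q i).2 : ℕ)) = π ^ (p - 1 - (q i).2) * B := fun i => by
    refine exists_isIntegral_aeval_pthRootDual (a := a i) hp ?_ hπ (q i).2.2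
    rw [← pow_mul, mul_comm, hω, hfh]
    simp
  choose B hB hBeq using hex
  have hle : ∑ i, ((q i).2 : ℕ) ≤ (p - 1) * radicalExponent p q + (p - 2) := by
    have h1 := Nat.div_add_mod (∑ i, ((q i).2 : ℕ)) (p - 1)
    have h2 := Nat.mod_lt (∑ i, ((q i).2 : ℕ)) (show 0 < p - 1 by omega)
    have h3 : (∑ i, ((q i).2 : ℕ)) / (p - 1) = radicalExponent p q := rfl
    rw [h3] at h1
    omega
  obtain ⟨m, hm⟩ := Nat.exists_eq_add_of_le hle
  refine ⟨(∏ i, (ω i ^ (d i - 1 - (q i).1) * B i)) * π ^ m,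
    (IsIntegral.prod _ fun i _ => ((hωint i).pow _).mul (hB i)).mul (hπint.pow m), ?_⟩
  have hpk : (p : Ω) ^ (radicalExponent p q + 1) = π * π ^ (∑ i, ((q i).2 : ℕ)) * π ^ m := by
    rw [mul_assoc, ← pow_add, ← hm, ← pow_succ', ← hπ, ← pow_mul]
    congr 1
    rw [mul_add, mul_one]
    omega
  have hpr : ∏ i : Fin r, (π ^ ((q i).2 : ℕ) * π ^ (p - 1 - (q i).2)) = (p : Ω) ^ r := by
    have : ∀ i, π ^ ((q i).2 : ℕ) * π ^ (p - 1 - (q i).2) = (p : Ω) := fun i => by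
      rw [← pow_add, ← hπ]
      congr 1
      have := (q i).2.2
      omega
    simp [this]
  rw [radicalDualElement, hpk, ← hpr, ← Finset.prod_pow_eq_pow_sum]
  simp_rw [aeval_radicalDualPoly, hBeq, Finset.prod_mul_distrib]
  ring

theorem div_mul_mul_eq_of_mul_eq {F : Type*} [Field F] {A P R D E Z δ w W : F} (hP : P ≠ 0)
    (hR : R ≠ 0) (hD : D ≠ 0) (hE : E ≠ 0) (h : A * P * δ = R * W * w) :
    A / (R * D * E) * (Z * δ) = Z * w * D⁻¹ * (W / (P * E)) := by
  field_simp
  linear_combination Z * h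

/-- The coordinates of an integral element are integral. -/
theorem exists_algebraMap_eq_radicalCoord [IsDomain S] [IsIntegrallyClosed S] [IsFractionRing S L]
    [IsScalarTower S L K] [CharZero L] [FiniteDimensional L K] {p : ℕ} (hp : p.Prime)
    {d : Fin r → ℕ} (hd : ∀ i, IsUnit (d i : S)) (hd0 : ∀ i, d i ≠ 0) {f h a : Fin r → S}
    (hf : ∀ i, f i ≠ 0) (hfh : ∀ i, f i = h i ^ p + p ^ 2 * a i) {ω : Fin r → K}
    (hω : ∀ i, ω i ^ (p * d i) = algebraMap S K (f i))
    (hrad : ∀ (x : S) (D : ℕ), (p * ∏ i, f i) ∣ x ^ D → (p * ∏ i, f i) ∣ x)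
    (q : ∀ i, Fin (d i) × Fin p) {z : K} (hz : IsIntegral S z) :
    ∃ s : S, algebraMap S L s = radicalCoord L p f h ω q z := by
  let Ω := AlgebraicClosure K
  have hSL := IsFractionRing.injective S L
  have : CharZero K := charZero_of_injective_algebraMap (algebraMap L K).injective
  have : CharZero Ω := charZero_of_injective_algebraMap (algebraMap K Ω).injective
  have hSΩ : Function.Injective (algebraMap S Ω) := by
    rw [IsScalarTower.algebraMap_eq S L Ω]
    exact (algebraMap L Ω).injective.comp hSL
  have : FaithfulSMul S Ω := (faithfulSMul_iff_algebraMap_injective S Ω).2 hSΩ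
  have hp2 := hp.two_le
  have hn : ∀ i, p * d i ≠ 0 := fun i => mul_ne_zero hp.ne_zero (hd0 i)
  obtain ⟨π, hπ⟩ := IsAlgClosed.exists_pow_nat_eq (p : Ω) (show 0 < p - 1 by omega)
  let ψ : Fin r → Ω := fun i => algebraMap K Ω (ω i)
  have hψ : ∀ i, ψ i ^ (p * d i) = algebraMap S Ω (f i) := fun i => by
    rw [← map_pow, hω, ← IsScalarTower.algebraMap_apply]
  have hψint : ∀ i, IsIntegral S (ψ i) := fun i =>
    IsIntegral.of_pow (Nat.pos_of_ne_zero (hn i)) <| by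
      rw [hψ]
      exact isIntegral_algebraMap
  have hfΩ : ∀ i, algebraMap S Ω (f i) ≠ 0 := fun i => (map_ne_zero_iff _ hSΩ).2 (hf i)
  have hψ0 : ∀ i, ψ i ≠ 0 := fun i h0 => by
    have := hψ i
    rw [h0, zero_pow (hn i)] at this
    exact hfΩ i this.symm
  have hp0 : (p : Ω) ≠ 0 := Nat.cast_ne_zero.2 hp.ne_zero
  have hπ0 : π ≠ 0 := by
    rintro rfl
    rw [zero_pow (by omega)] at hπ
    exact hp0 hπ.symm
  have hπint : IsIntegral S π := IsIntegral.of_pow (n := p - 1) (by omega) <| by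
    rw [hπ]
    exact isIntegral_natCast p
  obtain ⟨w, hw, hweq⟩ := exists_isIntegral_radicalDualElement hp hfh hψ hπ hψint q
  have hdual : algebraMap K Ω (radicalDualElement p h ω q) = radicalDualElement p h ψ q := by
    rw [radicalDualElement, radicalDualElement, map_prod]
    refine Finset.prod_congr rfl fun i _ => ?_
    rw [map_mul, aeval_algebraMap_apply]
  choose u hu using fun i => (hd i).exists_right_inv
  set G : S := p * ∏ i, f i with hG
  have hG0 : G ≠ 0 := by
    refine mul_ne_zero ?_ (Finset.prod_ne_zero_iff.2 fun i _ => hf i)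
    intro h0
    apply hp0
    rw [← map_natCast (algebraMap S Ω) p, h0, map_zero]
  have hGΩ : algebraMap S Ω G ≠ 0 := (map_ne_zero_iff _ hSΩ).2 hG0
  let W : Ω := π * ∏ i, ψ i
  have hW0 : W ≠ 0 := mul_ne_zero hπ0 (Finset.prod_ne_zero_iff.2 fun i _ => hψ0 i)
  have hWint : IsIntegral S W := hπint.mul (IsIntegral.prod _ fun i _ => hψint i)
  let N := ∏ i, p * d i
  have hN0 : N ≠ 0 := Finset.prod_ne_zero_iff.2 fun i _ => hn i
  -- `p - 1` clears the root `π` and `N` clears all the `ω i`, so `W ^ D` lies in `S` and contains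
  -- `p` and each `f i` to a positive power.
  let D := (p - 1) * N
  have hD : D ≠ 0 := mul_ne_zero (by omega) hN0
  have hWD : ∃ b, W ^ D = algebraMap S Ω (G * b) := by
    have hψD : ∀ i, ∃ b : S, ψ i ^ D = algebraMap S Ω (f i * b) := fun i => by
      obtain ⟨e, he⟩ := (Finset.dvd_prod_of_mem (fun i => p * d i) (Finset.mem_univ i)).mul_left
        (p - 1)
      have he' : D = p * d i * e := he
      have he0 : e ≠ 0 := by
        rintro rfl
        exact hD he'
      refine ⟨f i ^ (e - 1), ?_⟩
      rw [← pow_succ', Nat.sub_add_cancel (Nat.pos_of_ne_zero he0), he', pow_mul, hψ, map_pow]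
    choose b hb using hψD
    refine ⟨p ^ (N - 1) * ∏ i, b i, ?_⟩
    rw [mul_pow, pow_mul, hπ, ← Finset.prod_pow, Finset.prod_congr rfl fun i _ => hb i, ← map_prod,
      Finset.prod_mul_distrib, ← Nat.sub_add_cancel (Nat.pos_of_ne_zero hN0), Nat.add_sub_cancel,
      pow_succ, ← map_natCast (algebraMap S Ω) p, ← map_pow, ← map_mul, ← map_mul, hG]
    congr 1
    ring
  obtain ⟨b, hb⟩ := hWD
  set c₀ : L := (p : L) ^ radicalExponent p q /
    ((∏ i, ((p * d i : ℕ) : L)) * ∏ i, algebraMap S L (f i)) with hc₀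
  set y : K := c₀ • (z * radicalDualElement p h ω q) with hy
  have hcoord : radicalCoord L p f h ω q z = Algebra.trace L K y := by
    rw [hy, map_smul, radicalCoord]
    rfl
  have hyW : algebraMap K Ω y / (W / algebraMap S Ω G) =
      algebraMap K Ω z * w * algebraMap S Ω (∏ i, u i) := by
    have hdΩ : (∏ i, (d i : Ω)) * algebraMap S Ω (∏ i, u i) = 1 := by
      rw [map_prod, ← Finset.prod_mul_distrib]
      refine Finset.prod_eq_one fun i _ => ?_
      rw [← map_natCast (algebraMap S Ω), ← map_mul, hu, map_one]
    have hd0Ω : (∏ i, (d i : Ω)) ≠ 0 := left_ne_zero_of_mul_eq_one hdΩ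
    have hF0 : (∏ i, algebraMap S Ω (f i)) ≠ 0 := Finset.prod_ne_zero_iff.2 fun i _ => hfΩ i
    have hc₀Ω : algebraMap L Ω c₀ = (p : Ω) ^ radicalExponent p q /
        ((p : Ω) ^ r * (∏ i, (d i : Ω)) * ∏ i, algebraMap S Ω (f i)) := by
      rw [hc₀, map_div₀, map_mul, map_prod, map_prod, map_pow, map_natCast]
      simp [Finset.prod_mul_distrib, ← IsScalarTower.algebraMap_apply]
    have hGeq : algebraMap S Ω G = p * ∏ i, algebraMap S Ω (f i) := by
      rw [hG, map_mul, map_natCast, map_prod]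
    rw [hy, Algebra.smul_def, map_mul, ← IsScalarTower.algebraMap_apply L K Ω, hc₀Ω, map_mul, hdual,
      hGeq, div_eq_iff (div_ne_zero hW0 (by rw [← hGeq]; exact hGΩ)),
      eq_inv_of_mul_eq_one_right hdΩ]
    have hwW : (p : Ω) ^ radicalExponent p q * p * radicalDualElement p h ψ q = p ^ r * W * w := by
      rw [← pow_succ, hweq]
      ring
    exact div_mul_mul_eq_of_mul_eq hp0 (pow_ne_zero r hp0) hd0Ω hF0 hwW
  have hγ : (W / algebraMap S Ω G) ^ D = algebraMap L Ω (algebraMap S L (G * b) /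
      algebraMap S L G ^ D) := by
    rw [div_pow, hb, map_div₀, map_pow, ← IsScalarTower.algebraMap_apply,
      ← IsScalarTower.algebraMap_apply]
  have hx₀ := isIntegral_trace_div (y := y) hD hγ <| by
    rw [hyW]
    exact (hz.algebraMap.mul hw).mul isIntegral_algebraMap
  set x₀ := algebraMap L Ω (Algebra.trace L K y) / (W / algebraMap S Ω G) with hx₀def
  have hcG : algebraMap L Ω (Algebra.trace L K y * algebraMap S L G) = x₀ * W := by
    rw [hx₀def, map_mul, ← IsScalarTower.algebraMap_apply]
    rw [div_div_eq_mul_div, div_mul_cancel₀ _ hW0]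
  have hint : IsIntegral S (Algebra.trace L K y * algebraMap S L G) := by
    rw [← isIntegral_algebraMap_iff (algebraMap L Ω).injective, hcG]
    exact hx₀.mul hWint
  obtain ⟨x, hx⟩ := IsIntegrallyClosed.isIntegral_iff.1 hint
  -- Here `x = x₀ * W` with `x₀` integral, so `x ^ D` is an integral multiple of `W ^ D = G * b`. As
  -- `G` is radical, `G ∣ x`.
  have hdvd : G ∣ x := by
    refine hrad x D (dvd_of_algebraMap_eq_mul_isIntegral (E := Ω)
      ((hx₀.pow D).mul (isIntegral_algebraMap (x := b))) ?_)
    rw [map_pow, IsScalarTower.algebraMap_apply S L Ω, hx, hcG, mul_pow, hb, map_mul]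
    ring
  obtain ⟨s, rfl⟩ := hdvd
  refine ⟨s, ?_⟩
  rw [hcoord]
  apply mul_right_cancel₀ ((map_ne_zero_iff _ hSL).2 hG0)
  rw [← hx, ← map_mul, mul_comm]

end RadicalBasis

/-! ### Freeness criterion, square-free products and the main theorem. -/

theorem charZero_of_prime_natCast {S : Type*} [CommRing S] [IsDomain S] {p : ℕ} (hp : p.Prime)
    (hpS : Prime (p : S)) : CharZero S := by
  obtain ⟨q, hq⟩ := CharP.exists S
  rcases CharP.char_is_prime_or_zero S q with hqp | rfl
  · exfalso
    have hndvd : ¬ q ∣ p := fun h => hpS.ne_zero ((CharP.cast_eq_zero_iff S q p).2 h)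
    have hcop : IsCoprime (p : ℤ) q :=
      Nat.isCoprime_iff_coprime.2 ((Nat.coprime_primes hp hqp).2 fun h => hndvd (h ▸ dvd_rfl))
    obtain ⟨a, b, hab⟩ := hcop
    have h := congrArg (Int.cast : ℤ → S) hab
    push_cast at h
    rw [CharP.cast_eq_zero S q, mul_zero, add_zero] at h
    exact hpS.not_isUnit (IsUnit.of_mul_eq_one_right _ h)
  · exact CharP.charP_to_charZero S

/-- A family of elements of the integral closure which is dual to linear forms that are integral on
it forms a basis. -/
theorem free_integralClosure_of_dual {S L K κ : Type*} [CommRing S] [Field L] [Field K]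
    [Algebra S L] [Algebra L K] [Algebra S K] [IsScalarTower S L K] [FaithfulSMul S L] [Fintype κ]
    [DecidableEq κ] [FiniteDimensional L K] (hcard : Fintype.card κ = Module.finrank L K)
    (b : κ → K) (hb : ∀ q, IsIntegral S (b q)) (φ : κ → K →ₗ[L] L)
    (hφ : ∀ q q', φ q (b q') = if q' = q then 1 else 0)
    (hφint : ∀ q z, IsIntegral S z → ∃ s : S, algebraMap S L s = φ q z) :
    Module.Free S (integralClosure S K) ∧ Module.Finite S (integralClosure S K) := by
  have hli : LinearIndependent L b :=
    LinearIndependent.of_pairwise_dual_eq_zero_one b φ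
      (fun q q' hqq => (hφ q q').trans (if_neg hqq.symm)) fun q => by rw [hφ, if_pos rfl]
  have : Nonempty κ := Fintype.card_pos_iff.1 (hcard ▸ Module.finrank_pos)
  let B := basisOfLinearIndependentOfCardEqFinrank hli hcard
  have hB : ∀ q, B q = b q := fun q => by simp [B]
  have hcoord : ∀ q z, B.repr z q = φ q z := fun q z => by
    have : B.coord q = φ q := B.ext fun q' => by
      rw [B.coord_apply, B.repr_self, hB, hφ, Finsupp.single_apply]
    rw [← this, B.coord_apply]
  let b' : κ → integralClosure S K := fun q => ⟨b q, hb q⟩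
  have hliS : LinearIndependent S b' := by
    have hliK : LinearIndependent S b := hli.restrict_scalars' S
    exact LinearIndependent.of_comp (integralClosure S K).val.toLinearMap hliK
  have hspan : ⊤ ≤ Submodule.span S (Set.range b') := by
    rintro ⟨z, hz⟩ -
    choose s hs using fun q => hφint q z hz
    have hsum : (⟨z, hz⟩ : integralClosure S K) = ∑ q, s q • b' q := by
      apply Subtype.ext
      have h1 := B.sum_repr z
      simp_rw [hcoord, ← hs, hB, algebraMap_smul] at h1
      refine h1.symm.trans ?_
      simp [b']
    rw [hsum]
    exact sum_mem fun q _ => Submodule.smul_mem _ _ (Submodule.subset_span ⟨q, rfl⟩)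
  let B' := Module.Basis.mk hliS hspan
  exact ⟨.of_basis B', .of_basis B'⟩

section SquareFree

variable {S : Type*} [CommRing S] [IsDomain S] {p r : ℕ} {f : Fin r → S}

theorem natCast_notMem_of_height_eq_one (hpS : Prime (p : S)) {g : S} (hpg : ¬ (p : S) ∣ g)
    {Q : Ideal S} (hQ : Q.IsPrime) (hQ1 : Q.height = 1) (hgQ : g ∈ Q) : (p : S) ∉ Q := by
  intro hpQ
  rw [Ideal.eq_span_singleton_of_height_eq_one hQ1 hpQ hpS, Ideal.mem_span_singleton] at hgQ
  exact hpg hgQ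

/-- A height one prime containing the product contains exactly one of its factors, and that factor
generates the prime locally; the other factors become units there. -/
theorem dvd_of_natCast_mul_prod_dvd_pow [IsNoetherianRing S] [IsIntegrallyClosed S] (hpS : Prime (p : S))
    (hf0 : ∀ i, f i ≠ 0) (hf : ∀ i, IsSquareFreeElement (f i)) (hff : NoCommonHeightOnePrime f)
    (hpf : ∀ i, ¬ (p : S) ∣ f i) (x : S) (D : ℕ) (hx : (p * ∏ i, f i) ∣ x ^ D) :
    (p * ∏ i, f i) ∣ x := by
  classical
  refine dvd_of_dvd_pow_of_forall_height_eq_one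
    (mul_ne_zero hpS.ne_zero (Finset.prod_ne_zero_iff.2 fun i _ => hf0 i))
    (fun Q hQ hQ1 hGQ q hq => ?_) hx
  rcases hQ.mem_or_mem hGQ with hpQ | hFQ
  · have hQp := Ideal.eq_span_singleton_of_height_eq_one hQ1 hpQ hpS
    refine ⟨∏ i, f i, ?_, ?_⟩
    · rw [hQp, Ideal.mem_span_singleton, hpS.dvd_finsetProd_iff]
      rintro ⟨i, -, hi⟩
      exact hpf i hi
    · rw [hQp, Ideal.mem_span_singleton] at hq
      rw [mul_comm]
      exact mul_dvd_mul_left _ hq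
  · obtain ⟨i, -, hi⟩ := hQ.prod_mem_iff.1 hFQ
    obtain ⟨u, hu, hfu⟩ := (hf i).exists_dvd_mul hQ hQ1 hi hq
    refine ⟨p * (∏ j ∈ Finset.univ.erase i, f j) * u, ?_, ?_⟩
    · intro hmem
      rcases hQ.mem_or_mem hmem with hmem | hmem
      · rcases hQ.mem_or_mem hmem with hmem | hmem
        · exact natCast_notMem_of_height_eq_one hpS (hpf i) hQ hQ1 hi hmem
        · obtain ⟨j, hj, hfj⟩ := hQ.prod_mem_iff.1 hmem
          exact hff i j (Finset.ne_of_mem_erase hj).symm Q hQ hQ1 ⟨hi, hfj⟩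
      · exact hu hmem
    · rw [← Finset.mul_prod_erase _ _ (Finset.mem_univ i), mul_comm (f i), ← mul_assoc,
        mul_assoc _ u]
      exact mul_dvd_mul_left _ hfu

theorem exists_height_eq_one_mem [IsNoetherianRing S] {g : S} (hg0 : g ≠ 0) (hg : ¬ IsUnit g) :
    ∃ Q : Ideal S, Q.IsPrime ∧ Q.height = 1 ∧ g ∈ Q := by
  obtain ⟨Q, hQ⟩ := (Ideal.span {g}).nonempty_minimalPrimes (by simpa)
  have hQp := hQ.1.1
  have hgQ : g ∈ Q := hQ.1.2 (Ideal.mem_span_singleton_self g)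
  refine ⟨Q, hQp, le_antisymm (Ideal.height_le_one_of_isPrincipal_of_mem_minimalPrimes _ _ hQ) ?_,
    hgQ⟩
  rw [Order.one_le_iff_pos, pos_iff_ne_zero, Ne, Ideal.height_eq_zero_iff_eq_bot]
  rintro rfl
  exact hg0 (by simpa using hgQ)

end SquareFree

theorem theorem3p5 {S : Type*} [CommRing S] [IsDomain S] [IsNoetherianRing S]
    [IsIntegrallyClosed S]
    {L : Type*} [Field L] [Algebra S L] [IsFractionRing S L]
    {K : Type*} [Field K] [Algebra L K] [Algebra S K] [IsScalarTower S L K]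
    (p : ℕ) (hp : p.Prime) (hpS : Prime (p : S))
    (r : ℕ) (f : Fin r → S)
    (hf_ne_zero : ∀ i, f i ≠ 0) (hf_nonunit : ∀ i, ¬ IsUnit (f i))
    (hf_squarefree : ∀ i, IsSquareFreeElement (f i))
    (hf_A1 : NoCommonHeightOnePrime f)
    (hf_pow : ∀ i, IsPthPowerModSq p (f i))
    (n d : Fin r → ℕ) (hn : ∀ i, n i = p * d i) (hd : ∀ i, IsUnit (d i : S))
    (ω : Fin r → K) (hω : ∀ i, ω i ^ n i = algebraMap S K (f i))
    (hK : IntermediateField.adjoin L (Set.range ω) = ⊤) :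
    Module.Free S (integralClosure S K) ∧
      (IsCohenMacaulayRing S ∨ IsUnramifiedRegularLocalRing p S →
        IsCohenMacaulayRing (integralClosure S K)) := by

  classical
  have hS : CharZero S := charZero_of_prime_natCast hp hpS
  have hSL := IsFractionRing.injective S L
  have hL : CharZero L := charZero_of_injective_algebraMap hSL
  have hK0 : CharZero K := charZero_of_injective_algebraMap (algebraMap L K).injective
  obtain rfl : n = fun i => p * d i := funext hn
  have hd0 : ∀ i, d i ≠ 0 := fun i h0 => by
    have := hd i
    rw [h0, Nat.cast_zero] at this
    exact not_isUnit_zero this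
  have hn0 : ∀ i, p * d i ≠ 0 := fun i => mul_ne_zero hp.ne_zero (hd0 i)
  have hpf : ∀ i, ¬ (p : S) ∣ f i := fun i =>
    (hf_squarefree i).not_dvd_of_isPthPowerModSq hp hpS (hf_pow i)
  have hfree : Module.Free S (integralClosure S K) ∧ Module.Finite S (integralClosure S K) := by
    have hli := linearIndependent_prod_pow (L := L) r hn0 hf_ne_zero
      (fun i x D hx => dvd_of_dvd_pow_of_forall_height_eq_one (hf_ne_zero i)
        (fun Q hQ hQ1 hfQ q hq => (hf_squarefree i).exists_dvd_mul hQ hQ1 hfQ hq) hx)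
      (fun i => by
        -- A height one prime over `f i` avoids `p`, since otherwise it would be `(p)` and `p` would
        -- divide `f i`. It also avoids the units `d j` and the other `f j`.
        obtain ⟨Q, hQ, hQ1, hfQ⟩ := exists_height_eq_one_mem (hf_ne_zero i) (hf_nonunit i)
        refine ⟨Q, hQ, hfQ, fun j hmem => ?_, fun j hj hfj => hf_A1 i j hj.symm Q hQ hQ1 ⟨hfQ, hfj⟩⟩
        rw [Nat.cast_mul] at hmem
        rcases hQ.mem_or_mem hmem with hmem | hmem
        · exact natCast_notMem_of_height_eq_one hpS (hpf i) hQ hQ1 hfQ hmem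
        · exact hQ.ne_top (Ideal.eq_top_of_isUnit_mem Q hmem (hd j))) hω
    have hωL : ∀ i, ω i ^ (p * d i) = algebraMap L K (algebraMap S L (f i)) := fun i => by
      rw [hω, IsScalarTower.algebraMap_apply S L K]
    let B : Module.Basis (∀ i, Fin (p * d i)) L K :=
      Module.Basis.mk hli (span_range_prod_pow_eq_top hn0 hωL hK).ge
    have hB : ∀ m, B m = ∏ i, ω i ^ (m i : ℕ) := fun m => Module.Basis.mk_apply _ _ m
    have hfd : FiniteDimensional L K := B.finiteDimensional_of_finite
    choose h hh using hf_pow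
    simp_rw [Ideal.mem_span_singleton'] at hh
    choose a ha using hh
    have hfh : ∀ i, f i = h i ^ p + p ^ 2 * a i := fun i => by linear_combination -(ha i)
    have hωint : ∀ i, IsIntegral S (ω i) := fun i =>
      IsIntegral.of_pow (Nat.pos_of_ne_zero (hn0 i)) <| by
        rw [hω]
        exact isIntegral_algebraMap
    refine free_integralClosure_of_dual (L := L) (κ := ∀ i, Fin (d i) × Fin p) ?_
      (radicalBasisElement p h ω) (fun q => ?_) (radicalCoord L p f h ω)
      (radicalCoord_radicalBasisElement hp hd0
        (fun i => (map_ne_zero_iff _ hSL).2 (hf_ne_zero i)) hω B hB)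
      fun q z hz => exists_algebraMap_eq_radicalCoord hp hd hd0 hf_ne_zero hfh hω
        (dvd_of_natCast_mul_prod_dvd_pow hpS hf_ne_zero hf_squarefree hf_A1 hpf) q hz
    · rw [Module.finrank_eq_card_basis B]
      simp [mul_comm]
    · let Ω := AlgebraicClosure K
      have : CharZero Ω := charZero_of_injective_algebraMap (algebraMap K Ω).injective
      obtain ⟨π, hπ⟩ := IsAlgClosed.exists_pow_nat_eq (p : Ω)
        (show 0 < p - 1 from Nat.sub_pos_of_lt hp.one_lt)
      rw [← isIntegral_algebraMap_iff (algebraMap K Ω).injective]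
      have hmap : algebraMap K Ω (radicalBasisElement p h ω q) =
          radicalBasisElement p h (fun i => algebraMap K Ω (ω i)) q := by
        rw [radicalBasisElement, radicalBasisElement, map_div₀, map_prod, map_pow, map_natCast]
        congr 1
        exact Finset.prod_congr rfl fun i _ => (Polynomial.aeval_algebraMap_apply _ _ _).symm
      rw [hmap]
      refine isIntegral_radicalBasisElement hp hfh (fun i => ?_) hπ (fun i => (hωint i).algebraMap) q
      rw [← map_pow, hω, ← IsScalarTower.algebraMap_apply]
  obtain ⟨h1, h2⟩ := hfree
  refine ⟨h1, fun hCM => IsCohenMacaulayRing.of_finite_of_flat (A := S) ?_⟩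
  rcases hCM with hCM | hreg
  · exact hCM
  · have := hreg.toIsRegularLocalRing
    exact IsRegularLocalRing.isCohenMacaulayRing S
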